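/- **Setting.** Let $M$ be a smooth (finite-dimensional, Hausdorff, $\sigma$-compact) manifold with a pseudo-Riemannian metric $g$. Let $C_c^\infty(M)$ and $\Omega^1_c(M)$ be the compactly supported smooth complex-valued functions and complex one-forms, and $\Gamma_c(M,V)$ the compactly supported smooth sections of a complex vector bundle $V$. *Smooth deformation.* A smooth deformation of $M$ consists of a commutative $\mathbb C$-algebra $\Bbbk$, an element $\kappa\in\Bbbk$, a (possibly non-unital) associative $\Bbbk$-algebra $\mathbb A$ and an algebra isomorphism $\mathbb A/\kappa\mathbb A\cong C_c^\infty(M)$, such that $\mathbb A/\kappa^3\mathbb A$ is a free $\mathbb C[\kappa]/\kappa^3$-module. It determines a bracket $\{f,h\}$ on $C_c^\infty(M)$ by $\kappa\{f,h\}=i(ab-ba) \bmod \kappa^2$, where $f=a\bmod\kappa$ and $h=b\bmod\kappa$. *Bimodule deformation.* A bimodule deformation of $V$ is an $\mathbb A$-bimodule $\mathbb V$ (over $\Bbbk$) with a $C_c^\infty(M)$-bimodule isomorphism $\mathbb V/\kappa\mathbb V\cong\Gamma_c(M,V)$, such that $\mathbb V/\kappa^3\mathbb V$ is a free $\mathbb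 C[\kappa]/\kappa^3$-module. It determines a bracket $\{f,v\}\in\Gamma_c(M,V)$ by $\kappa\{f,v\}=i(a\hat v-\hat v a)\bmod\kappa^2$, where $f=a\bmod\kappa$ and $v=\hat v\bmod\kappa$. A deformation of one-forms is a bimodule deformation $\Omega^1$ of the (complexified) cotangent bundle with a $\Bbbk$-linear derivation $d:\mathbb A\to\Omega^1$ that reduces modulo $\kappa$ to $d:C_c^\infty(M)\to\Omega_c^1(M)$. *Deformed spectral triple.* Let $V$ be a Spin bundle: a complex vector bundle of finite positive rank with a smooth complex-linear Clifford multiplication $c$ by covectors, $c(\sigma)c(\rho)+c(\rho)c(\sigma)=2g^{ij}\sigma_i\rho_j$. A deformed spectral triple $(\mathbb A,\mathbb V,D)$ consists of a smooth deformation $\mathbb A$ of $M$, a bimodule deformation $\mathbb V$ of $V$, and a $\Bbbk$-linear operator $D:\mathbb V\to\mathbb V$ such that 1. $D$ reduces modulo $\kappa$ to a Dirac-type operator $D_0$ on $\Gamma_c(M,V)$, i.e. a linear operator with $[D_0,f]=i\,c(df)$ for all $f\in C^\infty_c(M)$; 2. for each $a\in\mathbb A$, the operator $[D,a]$ (with $a$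 acting from the left) commutes with right multiplication by $\mathbb A$ on $\mathbb V$; 3. the sub-$\mathbb A$-bimodule $\Omega^1_D\subset\mathrm{End}_\Bbbk(\mathbb V)$ generated by all $[D,a]$, $a\in\mathbb A$, with $da=-i[D,a]$, is a deformation of one-forms. *Contravariant connections.* Let $\pi$ be a (complex) Poisson bivector field, with $\{f,h\}=\pi(df,dh)$ and $(\#\sigma)^j=\pi^{ij}\sigma_i$. The Koszul bracket $[\cdot,\cdot]_\pi$ is the antisymmetric bilinear bracket on $\Omega_c^1(M)$ with $[df,dh]_\pi=d\{f,h\}$ and $[\sigma,f\rho]_\pi=\#\sigma(f)\rho+f[\sigma,\rho]_\pi$. A contravariant connection on a complex vector bundle $U$ is a linear map $\sigma\mapsto\mathcal D_\sigma$ from $\Omega_c^1(M)$ to operators on $\Gamma_c(M,U)$ with $\mathcal D_{f\sigma}v=f\mathcal D_\sigma v$ and $\mathcal D_\sigma(fv)=\#\sigma(f)v+f\mathcal D_\sigma v$. **Theorem.** Let $(\mathbb A,\mathbb V,D)$ be a deformed spectral triple for $(M,g)$. - There is a unique bivector field $\pi$ on $M$ such that the bracket determined by $\mathbb A$ is $\{f,h\}=\pi(df,dh)$;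 it is a Poisson field (the bracket satisfies the Jacobi identity), and it has a unique Koszul bracket. - There is a unique contravariant connection $\mathcal D$ on $T^*M$ (with respect to $\pi$) such that $\mathcal D_{df}\sigma=\{f,\sigma\}$ for all $f\in C_c^\infty(M)$ and $\sigma\in\Omega_c^1(M)$, where $\{f,\sigma\}$ is the bracket determined by the bimodule deformation $\Omega^1_D$ of $T^*M$. - For all $\sigma,\rho,\tau\in\Omega^1_c(M)$ the connection $\mathcal D$ satisfies - (flat) $\mathcal D_\sigma\mathcal D_\rho\tau-\mathcal D_\rho\mathcal D_\sigma\tau-\mathcal D_{[\sigma,\rho]_\pi}\tau=0$; - (torsion-free) $\mathcal D_\sigma\rho-\mathcal D_\rho\sigma-[\sigma,\rho]_\pi=0$; - (metric compatible, $\mathcal D^ig^{jk}=0$) $\#\sigma\big(g(\rho,\tau)\big)=g(\mathcal D_\sigma\rho,\tau)+g(\rho,\mathcal D_\sigma\tau)$, where $g(\rho,\tau)=g^{jk}\rho_j\tau_k$. -/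

import Mathlib

open scoped Manifold ContDiff Polynomial

noncomputable section

namespace DeformedGeometry

/-! ### Smooth functions, complex vector bundles and compactly supported sections

`M` is a smooth manifold modelled on the finite dimensional real vector space `E`. -/

/-- A real vector bundle whose fibres are complex vector spaces is a complex vector bundle when
its local trivializations are complex linear on each fibre. -/
class IsComplexBundle {B : Type*} [TopologicalSpace B] (F : Type*) [NormedAddCommGroup F]
    [NormedSpace ℝ F] [NormedSpace ℂ F] (V : B → Type*) [TopologicalSpace (Bundle.TotalSpace F V)]
    [∀ x, TopologicalSpace (V x)] [FiberBundle F V] [∀ x, AddCommGroup (V x)]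
    [∀ x, Module ℂ (V x)] : Prop where
  map_smul : ∀ (e : Bundle.Trivialization F (Bundle.TotalSpace.proj : Bundle.TotalSpace F V → B))
    [MemTrivializationAtlas e] (x : B), x ∈ e.baseSet → ∀ (z : ℂ) (v : V x),
      (e ⟨x, z • v⟩).2 = z • (e ⟨x, v⟩).2

section Sections

variable {E : Type*} [NormedAddCommGroup E] [NormedSpace ℝ E]
  (M : Type*) [TopologicalSpace M] [ChartedSpace E M]

variable (E) in
/-- `C_c^∞(M)`: the (in general non-unital) algebra of compactly supported smooth complex valued
functions. -/
def Cc : NonUnitalSubalgebra ℂ (M → ℂ) where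
  carrier := {f | ContMDiff 𝓘(ℝ, E) 𝓘(ℝ, ℂ) ∞ f ∧ HasCompactSupport f}
  add_mem' ha hb := ⟨ha.1.add hb.1, ha.2.add hb.2⟩
  zero_mem' := ⟨contMDiff_const, HasCompactSupport.zero⟩
  mul_mem' {a b} ha hb := by
    refine ⟨?_, ha.2.mul_right⟩
    have h : ContDiff ℝ ∞ (fun p : ℂ × ℂ => p.1 * p.2) := contDiff_fst.mul contDiff_snd
    exact h.contMDiff.comp (ha.1.prodMk_space hb.1)
  smul_mem' z a ha := by
    refine ⟨?_, ?_⟩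
    · have h : ContDiff ℝ ∞ (fun p : ℂ => z * p) := contDiff_const.mul contDiff_id
      exact h.contMDiff.comp ha.1
    · exact ha.2.smul_left (f := fun _ => z)

variable {M}
variable (F : Type*) [NormedAddCommGroup F] [NormedSpace ℝ F] [NormedSpace ℂ F]
  [IsScalarTower ℝ ℂ F]
  (V : M → Type*) [TopologicalSpace (Bundle.TotalSpace F V)] [∀ x, TopologicalSpace (V x)]
  [FiberBundle F V] [∀ x, AddCommGroup (V x)] [∀ x, Module ℂ (V x)] [IsComplexBundle F V]


/-- The product of a smooth complex function and a smooth section is smooth. -/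
theorem contMDiff_complex_smul {f : M → ℂ} {s : ∀ x, V x} (hf : ContMDiff 𝓘(ℝ, E) 𝓘(ℝ, ℂ) ∞ f)
    (hs : ContMDiff 𝓘(ℝ, E) (𝓘(ℝ, E).prod 𝓘(ℝ, F)) ∞ (fun x => Bundle.TotalSpace.mk' F x (s x))) :
    ContMDiff 𝓘(ℝ, E) (𝓘(ℝ, E).prod 𝓘(ℝ, F)) ∞
      (fun x => Bundle.TotalSpace.mk' F x (f x • s x)) := by
  intro x₀
  have h := hs x₀
  rw [Bundle.contMDiffAt_section] at h ⊢
  have hb : ContDiff ℝ ∞ (fun p : ℂ × F => p.1 • p.2) :=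
    ((ContinuousLinearMap.lsmul ℝ ℂ : ℂ →L[ℝ] F →L[ℝ] F).isBoundedBilinearMap).contDiff
  refine (hb.contMDiff.contMDiffAt.comp x₀ ((hf x₀).prodMk_space h)).congr_of_eventuallyEq ?_
  filter_upwards [(trivializationAt F V x₀).open_baseSet.mem_nhds
    (FiberBundle.mem_baseSet_trivializationAt F V x₀)] with x hx
  exact IsComplexBundle.map_smul (F := F) (V := V) _ x hx _ _

variable [∀ x, Module ℝ (V x)] [VectorBundle ℝ F V]

/-- `Γ_c(M, V)`: the compactly supported smooth sections of a complex vector bundle `V`. -/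
def Gc : Submodule ℂ (∀ x, V x) where
  carrier := {s | ContMDiff 𝓘(ℝ, E) (𝓘(ℝ, E).prod 𝓘(ℝ, F)) ∞
      (fun x => Bundle.TotalSpace.mk' F x (s x)) ∧ ∃ K : Set M, IsCompact K ∧ ∀ x ∉ K, s x = 0}
  add_mem' := by
    rintro s t ⟨hs, K, hK, hsK⟩ ⟨ht, L, hL, htL⟩
    refine ⟨ContMDiff.add_section hs ht, K ∪ L, hK.union hL, fun x hx => ?_⟩
    simp only [Set.mem_union, not_or] at hx
    simp [hsK x hx.1, htL x hx.2]
  zero_mem' := ⟨Bundle.contMDiff_zeroSection ℝ V, ∅, isCompact_empty, fun _ _ => rfl⟩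
  smul_mem' := by
    rintro z s ⟨hs, K, hK, hsK⟩
    refine ⟨?_, K, hK, fun x hx => by simp [hsK x hx]⟩
    exact contMDiff_complex_smul F V (f := fun _ => z) contMDiff_const hs

/-- Multiplication of a compactly supported section by a function in `C_c^∞(M)`. -/
instance : SMul (Cc E M) (Gc (E := E) F V) where
  smul f s := ⟨fun x => (f : M → ℂ) x • (s : ∀ x, V x) x, by
    obtain ⟨K, hK, hsK⟩ := s.2.2
    exact ⟨contMDiff_complex_smul F V f.2.1 s.2.1, K, hK, fun x hx => by simp [hsK x hx]⟩⟩

end Sections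

/-! ### One-forms -/

section Forms

variable {E : Type*} [NormedAddCommGroup E] [NormedSpace ℝ E]
  {M : Type*} [TopologicalSpace M] [ChartedSpace E M] [IsManifold 𝓘(ℝ, E) ∞ M]

/-- The (complexified) cotangent space at `x`, i.e. the real linear maps `T_x M → ℂ`. -/
abbrev CotC (E : Type*) [NormedAddCommGroup E] [NormedSpace ℝ E]
    {M : Type*} [TopologicalSpace M] [ChartedSpace E M] (x : M) : Type _ :=
  TangentSpace 𝓘(ℝ, E) x →L[ℝ] Bundle.Trivial M ℂ x

instance : IsComplexBundle (B := M) (E →L[ℝ] ℂ) (CotC E (M := M)) where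
  map_smul e he x hx z v := by
    obtain ⟨_, ⟨e₁, e₂, h₁, h₂, rfl⟩, rfl⟩ := he.out
    obtain rfl := Bundle.Trivial.eq_trivialization M ℂ e₂
    ext w
    have key : ∀ u : CotC E x, (Bundle.Trivialization.continuousLinearMap (RingHom.id ℝ) e₁
        (Bundle.Trivial.trivialization M ℂ) ⟨x, u⟩).2 w = u (e₁.symmL ℝ x w) := fun u => by
      rw [Bundle.Trivialization.continuousLinearMap_apply]
      simp
    exact (key (z • v)).trans (congrArg (z * ·) (key v)).symm

variable (E M) in
/-- `Ω_c^1(M)`: the compactly supported smooth complex one-forms. -/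
abbrev Omc : Submodule ℂ (∀ x : M, CotC E x) := Gc (E := E) (E →L[ℝ] ℂ) (CotC E (M := M))

/-- The gradient operator `d : C_c^∞(M) → Ω_c^1(M)`. -/
def grad : Cc E M →ₗ[ℂ] Omc E M where
  toFun f := ⟨fun x => mvfderiv 𝓘(ℝ, E) (f : M → ℂ) x, by
    refine ⟨fun x₀ => ?_, _, f.2.2, fun x hx => ?_⟩
    · have h := (f.2.1 x₀).mfderiv_const (m := ∞) (by simp)
      rw [contMDiffAt_hom_bundle]
      refine ⟨contMDiffAt_id, ?_⟩
      convert h using 2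
      ext w
      simp [inTangentCoordinates, ContinuousLinearMap.inCoordinates, mvfderiv]
      rfl
    · have h0 : (f : M → ℂ) =ᶠ[nhds x] fun _ => 0 := by
        filter_upwards [(isClosed_tsupport (f : M → ℂ)).isOpen_compl.mem_nhds hx] with y hy
        exact image_eq_zero_of_notMem_tsupport hy
      ext v
      simp [mvfderiv, h0.mfderiv_eq, mfderiv_const]
      rfl⟩
  map_add' f g := by
    ext x v
    have hf := (f.2.1 x).mdifferentiableAt (by simp)
    have hg := (g.2.1 x).mdifferentiableAt (by simp)
    exact congrArg (fun L : CotC E x => L v) (mvfderiv_add hf hg)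
  map_smul' z f := by
    ext x v
    have hf := (f.2.1 x).mdifferentiableAt (by simp)
    have h : HasMFDerivAt 𝓘(ℝ, E) 𝓘(ℝ, ℂ) (z • (f : M → ℂ)) x
        (z • (mvfderiv 𝓘(ℝ, E) (f : M → ℂ) x : TangentSpace 𝓘(ℝ, E) x →L[ℝ] ℂ)) :=
      ⟨hf.hasMFDerivAt.1.const_smul z, hf.hasMFDerivAt.2.const_smul z⟩
    exact congrArg (fun L : CotC E x => L v) h.mfderiv

end Forms

/-! ### Poisson fields and contravariant connections -/

section Poisson

variable (E : Type*) [NormedAddCommGroup E] [NormedSpace ℝ E]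
  (M : Type*) [TopologicalSpace M] [ChartedSpace E M] [IsManifold 𝓘(ℝ, E) ∞ M] [T2Space M]

/-- A smooth (complex) bivector field `π`, given by its alternating complex bilinear pairing
`π(σ, ρ) = π^{ij} σ_i ρ_j` on each cotangent space; smoothness is tested on one-forms. -/
structure BivectorField where
  toFun : ∀ x : M, CotC E x →ₗ[ℂ] CotC E x →ₗ[ℂ] ℂ
  alt : ∀ x σ, toFun x σ σ = 0
  smooth : ∀ σ ρ : Omc E M, ContMDiff 𝓘(ℝ, E) 𝓘(ℝ, ℂ) ∞ fun x => toFun x (σ.1 x) (ρ.1 x)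

variable {E M}

namespace BivectorField

variable (π : BivectorField E M)

/-- The function `π(σ, ρ)`. -/
def pair (σ ρ : Omc E M) : Cc E M :=
  ⟨fun x => π.toFun x (σ.1 x) (ρ.1 x), π.smooth σ ρ, by
    obtain ⟨K, hK, h⟩ := σ.2.2
    exact HasCompactSupport.intro' hK hK.isClosed fun x hx => by simp [h x hx]⟩

/-- The bracket of functions `{f, g} = π(df, dg)`. -/
def bracket (f g : Cc E M) : Cc E M := π.pair (grad f) (grad g)

/-- `π` is a Poisson field: its bracket satisfies the Jacobi identity. -/
def IsPoisson : Prop := ∀ f g h : Cc E M,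
  π.bracket f (π.bracket g h) + π.bracket g (π.bracket h f) + π.bracket h (π.bracket f g) = 0

/-- The directional derivative `(#σ)(f)`. The vector field `#σ` is given by
`(#σ)^j = π^{ij} σ_i`, so that `(#σ)(f) = π^{ij} σ_i ∂_j f = π(σ, df)`. -/
def sharpDeriv (σ : Omc E M) (f : Cc E M) : Cc E M := π.pair σ (grad f)

/-- `B` is the Koszul bracket `[·,·]_π` on one-forms: the antisymmetric bilinear bracket with
`[df, dg]_π = d{f, g}` and `[σ, f ρ]_π = (#σ)(f) ρ + f [σ, ρ]_π`. -/
structure IsKoszulBracket (B : Omc E M →ₗ[ℂ] Omc E M →ₗ[ℂ] Omc E M) : Prop where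
  antisymm : ∀ σ ρ, B σ ρ = -B ρ σ
  exact_exact : ∀ f g : Cc E M, B (grad f) (grad g) = grad (π.bracket f g)
  leibniz : ∀ (σ : Omc E M) (f : Cc E M) (ρ : Omc E M),
    B σ (f • ρ) = π.sharpDeriv σ f • ρ + f • B σ ρ

end BivectorField

/-- A contravariant connection (with respect to the bivector field `π`) on a complex vector
bundle `V`: a map `σ ↦ 𝒟_σ` from one-forms to operators on sections of `V`. (The Leibniz rule
makes each `𝒟_σ` a first order differential operator.) -/
structure ContravariantConnection (π : BivectorField E M)
    (F : Type*) [NormedAddCommGroup F] [NormedSpace ℝ F] [NormedSpace ℂ F] [IsScalarTower ℝ ℂ F]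
    (V : M → Type*) [TopologicalSpace (Bundle.TotalSpace F V)] [∀ x, TopologicalSpace (V x)]
    [FiberBundle F V] [∀ x, AddCommGroup (V x)] [∀ x, Module ℂ (V x)] [IsComplexBundle F V]
    [∀ x, Module ℝ (V x)] [VectorBundle ℝ F V] where
  op : Omc E M →ₗ[ℂ] Gc (E := E) F V →ₗ[ℂ] Gc (E := E) F V
  smul_left : ∀ (f : Cc E M) (σ : Omc E M) v, op (f • σ) v = f • op σ v
  leibniz : ∀ (σ : Omc E M) (f : Cc E M) v,
    op σ (f • v) = π.sharpDeriv σ f • v + f • op σ v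

/-- A contravariant connection on the cotangent bundle. -/
abbrev CotangentConnection (π : BivectorField E M) :=
  ContravariantConnection π (E →L[ℝ] ℂ) (CotC E (M := M))

variable {π : BivectorField E M}

/-- The curvature `K(σ, ρ) v = 𝒟_σ 𝒟_ρ v - 𝒟_ρ 𝒟_σ v - 𝒟_{[σ, ρ]_π} v`, where `B` is the Koszul
bracket. -/
def ContravariantConnection.curvature
    {F : Type*} [NormedAddCommGroup F] [NormedSpace ℝ F] [NormedSpace ℂ F] [IsScalarTower ℝ ℂ F]
    {V : M → Type*} [TopologicalSpace (Bundle.TotalSpace F V)] [∀ x, TopologicalSpace (V x)]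
    [FiberBundle F V] [∀ x, AddCommGroup (V x)] [∀ x, Module ℂ (V x)] [IsComplexBundle F V]
    [∀ x, Module ℝ (V x)] [VectorBundle ℝ F V]
    (𝒟 : ContravariantConnection π F V) (B : Omc E M →ₗ[ℂ] Omc E M →ₗ[ℂ] Omc E M)
    (σ ρ : Omc E M) (v : Gc (E := E) F V) : Gc (E := E) F V :=
  𝒟.op σ (𝒟.op ρ v) - 𝒟.op ρ (𝒟.op σ v) - 𝒟.op (B σ ρ) v

/-- The torsion `T(σ, ρ) = 𝒟_σ ρ - 𝒟_ρ σ - [σ, ρ]_π`, where `B` is the Koszul bracket. -/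
def ContravariantConnection.torsion (𝒟 : CotangentConnection π)
    (B : Omc E M →ₗ[ℂ] Omc E M →ₗ[ℂ] Omc E M) (σ ρ : Omc E M) : Omc E M :=
  𝒟.op σ ρ - 𝒟.op ρ σ - B σ ρ

end Poisson

/-! ### Pseudo-Riemannian metrics and Clifford bundles -/

section Metric

variable (E : Type*) [NormedAddCommGroup E] [NormedSpace ℝ E] [FiniteDimensional ℝ E]
  (M : Type*) [TopologicalSpace M] [ChartedSpace E M] [IsManifold 𝓘(ℝ, E) ∞ M]

/-- A smooth pseudo-Riemannian metric `g_{ij}` on `M`. -/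
structure PseudoRiemannianMetric where
  inner (x : M) : TangentSpace 𝓘(ℝ, E) x →L[ℝ] TangentSpace 𝓘(ℝ, E) x →L[ℝ] ℝ
  symm (x : M) (v w : TangentSpace 𝓘(ℝ, E) x) : inner x v w = inner x w v
  nondegenerate (x : M) (v : TangentSpace 𝓘(ℝ, E) x) : (∀ w, inner x v w = 0) → v = 0
  contMDiff : ContMDiff 𝓘(ℝ, E) (𝓘(ℝ, E).prod 𝓘(ℝ, E →L[ℝ] E →L[ℝ] ℝ)) ∞
    (fun x => Bundle.TotalSpace.mk' (E →L[ℝ] E →L[ℝ] ℝ) x (inner x))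

variable {E M}

namespace PseudoRiemannianMetric

variable (g : PseudoRiemannianMetric E M)

/-- The lowering map `T_x M → T_x^* M`, `v ↦ g(v, ·)`. -/
def lower (x : M) : TangentSpace 𝓘(ℝ, E) x ≃ₗ[ℝ] (TangentSpace 𝓘(ℝ, E) x →L[ℝ] ℝ) :=
  haveI : FiniteDimensional ℝ (TangentSpace 𝓘(ℝ, E) x) := inferInstanceAs (FiniteDimensional ℝ E)
  LinearMap.linearEquivOfInjective (g.inner x : TangentSpace 𝓘(ℝ, E) x →ₗ[ℝ] _)
    (by
      rw [← LinearMap.ker_eq_bot, LinearMap.ker_eq_bot']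
      exact fun v hv => g.nondegenerate x v fun w => by
        simpa using congrArg (fun L : TangentSpace 𝓘(ℝ, E) x →L[ℝ] ℝ => L w) hv)
    (by
      have : T2Space (TangentSpace 𝓘(ℝ, E) x) := inferInstanceAs (T2Space E)
      have e : Module.Dual ℝ (TangentSpace 𝓘(ℝ, E) x) ≃ₗ[ℝ] (TangentSpace 𝓘(ℝ, E) x →L[ℝ] ℝ) :=
        LinearMap.toContinuousLinearMap
      exact Subspace.dual_finrank_eq.symm.trans e.finrank_eq)

@[simp]
theorem lower_apply (x : M) (v w : TangentSpace 𝓘(ℝ, E) x) : g.lower x v w = g.inner x v w := rfl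

/-- The inverse metric on complex covectors, `g^{ij} σ_i ρ_j`: if `u` is the tangent vector with
`g(u, ·) = Re σ` and `w` the one with `g(w, ·) = Im σ`, this is `ρ(u) + i ρ(w)`. -/
def cometric (x : M) (σ ρ : CotC E x) : ℂ :=
  ρ ((g.lower x).symm (Complex.reCLM.comp σ)) +
    Complex.I * ρ ((g.lower x).symm (Complex.imCLM.comp σ))

end PseudoRiemannianMetric

variable [T2Space M]

/-- Compatibility with the metric, `𝒟^i g^{jk} = 0`:
`(#σ)(g(ρ, τ)) = g(𝒟_σ ρ, τ) + g(ρ, 𝒟_σ τ)` for all one-forms, with `g` the inverse metric on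
one-forms. The derivative of the smooth function `h = g(ρ, τ)` along `#σ` is `π(σ, dh)`. -/
def ContravariantConnection.IsMetricCompatible {π : BivectorField E M}
    (𝒟 : CotangentConnection π) (g : PseudoRiemannianMetric E M) : Prop :=
  ∀ (σ ρ τ : Omc E M) (x : M),
    π.toFun x (σ.1 x) (mvfderiv 𝓘(ℝ, E) (fun y => g.cometric y (ρ.1 y) (τ.1 y)) x) =
      g.cometric x ((𝒟.op σ ρ).1 x) (τ.1 x) + g.cometric x (ρ.1 x) ((𝒟.op σ τ).1 x)

/-- A representation `c` of the bundle of Clifford algebras of `(T^*M, g)` on the complex vector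
bundle `V` (which makes `V` a Spin bundle). -/
structure CliffordRepresentation (g : PseudoRiemannianMetric E M)
    (F : Type*) [NormedAddCommGroup F] [NormedSpace ℝ F] [NormedSpace ℂ F] [IsScalarTower ℝ ℂ F]
    (V : M → Type*) [TopologicalSpace (Bundle.TotalSpace F V)] [∀ x, TopologicalSpace (V x)]
    [FiberBundle F V] [∀ x, AddCommGroup (V x)] [∀ x, Module ℂ (V x)] [IsComplexBundle F V]
    [∀ x, Module ℝ (V x)] [VectorBundle ℝ F V] where
  toFun : ∀ x : M, CotC E x →ₗ[ℂ] V x →ₗ[ℂ] V x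
  smooth : ∀ (σ : Omc E M) (v : Gc (E := E) F V),
    (fun x => toFun x (σ.1 x) (v.1 x)) ∈ Gc (E := E) F V
  clifford : ∀ (x : M) (σ ρ : CotC E x) (v : V x),
    toFun x σ (toFun x ρ v) + toFun x ρ (toFun x σ v) = (2 * g.cometric x σ ρ) • v

namespace CliffordRepresentation

variable {g : PseudoRiemannianMetric E M}
  {F : Type*} [NormedAddCommGroup F] [NormedSpace ℝ F] [NormedSpace ℂ F] [IsScalarTower ℝ ℂ F]
  {V : M → Type*} [TopologicalSpace (Bundle.TotalSpace F V)] [∀ x, TopologicalSpace (V x)]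
  [FiberBundle F V] [∀ x, AddCommGroup (V x)] [∀ x, Module ℂ (V x)] [IsComplexBundle F V]
  [∀ x, Module ℝ (V x)] [VectorBundle ℝ F V] (c : CliffordRepresentation g F V)

/-- Clifford multiplication `c(σ) v` of a section by a one-form. -/
def mul (σ : Omc E M) (v : Gc (E := E) F V) : Gc (E := E) F V :=
  ⟨fun x => c.toFun x (σ.1 x) (v.1 x), c.smooth σ v⟩

/-- `D₀` is a Dirac-type operator: `[D₀, f] = i c(df)` for every function `f`. -/
def IsDiracType (D₀ : Gc (E := E) F V →ₗ[ℂ] Gc (E := E) F V) : Prop :=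
  ∀ (f : Cc E M) (v : Gc (E := E) F V), D₀ (f • v) - f • D₀ v = Complex.I • c.mul (grad f) v

end CliffordRepresentation

end Metric

/-! ### Deformations -/

section Algebra

variable {𝕜 : Type*} [CommRing 𝕜]

/-- The ring homomorphism `ℂ[κ]/κ³ → 𝕜/κ³𝕜` determined by an element `κ ∈ 𝕜`. -/
def truncation [Algebra ℂ 𝕜] (κ : 𝕜) :
    (ℂ[X] ⧸ Ideal.span {(Polynomial.X : ℂ[X]) ^ 3}) →+* (𝕜 ⧸ Ideal.span {κ ^ 3}) :=
  Ideal.quotientMap _ (Polynomial.aeval κ : ℂ[X] →ₐ[ℂ] 𝕜).toRingHom (by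
    rw [Ideal.span_singleton_le_iff_mem, Ideal.mem_comap]
    simp)

/-- `W/κ³W` is a free `ℂ[κ]/κ³`-module. -/
def IsFreeToSecondOrder [Algebra ℂ 𝕜] (κ : 𝕜) (W : Type*) [AddCommGroup W] [Module 𝕜 W] : Prop :=
  letI : Module (ℂ[X] ⧸ Ideal.span {(Polynomial.X : ℂ[X]) ^ 3})
      (W ⧸ (Ideal.span {κ ^ 3} • ⊤ : Submodule 𝕜 W)) := Module.compHom _ (truncation κ)
  Module.Free (ℂ[X] ⧸ Ideal.span {(Polynomial.X : ℂ[X]) ^ 3})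
    (W ⧸ (Ideal.span {κ ^ 3} • ⊤ : Submodule 𝕜 W))

variable (𝕜) (A : Type*) [NonUnitalRing A] [Module 𝕜 A]

/-- A bimodule structure over the (possibly non-unital) `𝕜`-algebra `A` on the `𝕜`-module `W`:
`left a w` is `a w` and `right a w` is `w a`. -/
structure Bimod (W : Type*) [AddCommGroup W] [Module 𝕜 W] where
  left : A →ₗ[𝕜] W →ₗ[𝕜] W
  right : A →ₗ[𝕜] W →ₗ[𝕜] W
  left_mul : ∀ a b w, left (a * b) w = left a (left b w)
  right_mul : ∀ a b w, right (a * b) w = right b (right a w)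
  left_right : ∀ a b w, left a (right b w) = right b (left a w)

namespace Bimod

variable {𝕜 A} {W : Type*} [AddCommGroup W] [Module 𝕜 W]
  (β : Bimod 𝕜 A W) (D : W →ₗ[𝕜] W)

/-- The commutator `[D, a] = D a - a D` as an operator on `W`. -/
def comm (a : A) : W →ₗ[𝕜] W := D ∘ₗ β.left a - β.left a ∘ₗ D

/-- `Ω¹_D`: the noncommutative one-forms. This is the sub-`A`-bimodule of `End_𝕜(W)` generated by
all the commutators `[D, a]`; here `a η` and `η a` are composition with the left action of `a`. -/
def ncForms : Submodule 𝕜 (W →ₗ[𝕜] W) :=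
  sInf {S | (∀ a, β.comm D a ∈ S) ∧
    (∀ a, ∀ η ∈ S, β.left a ∘ₗ η ∈ S) ∧ ∀ a, ∀ η ∈ S, η ∘ₗ β.left a ∈ S}

theorem comm_mem (a : A) : β.comm D a ∈ β.ncForms D :=
  (Submodule.mem_sInf).2 fun _ hS => hS.1 a

theorem left_comp_mem (a : A) {η : W →ₗ[𝕜] W} (h : η ∈ β.ncForms D) :
    β.left a ∘ₗ η ∈ β.ncForms D :=
  (Submodule.mem_sInf).2 fun S hS => hS.2.1 a η ((Submodule.mem_sInf).1 h S hS)

theorem comp_left_mem (a : A) {η : W →ₗ[𝕜] W} (h : η ∈ β.ncForms D) :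
    η ∘ₗ β.left a ∈ β.ncForms D :=
  (Submodule.mem_sInf).2 fun S hS => hS.2.2 a η ((Submodule.mem_sInf).1 h S hS)

/-- The bimodule structure of `Ω¹_D`. -/
def ncBimod : Bimod 𝕜 A (β.ncForms D) where
  left := LinearMap.mk₂ 𝕜 (fun a η => ⟨β.left a ∘ₗ η.1, β.left_comp_mem D a η.2⟩)
    (by intros; ext; simp) (by intros; ext; simp) (by intros; ext; simp) (by intros; ext; simp)
  right := LinearMap.mk₂ 𝕜 (fun a η => ⟨η.1 ∘ₗ β.left a, β.comp_left_mem D a η.2⟩)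
    (by intros; ext; simp) (by intros; ext; simp) (by intros; ext; simp) (by intros; ext; simp)
  left_mul a b η := by ext w; simp [β.left_mul]
  right_mul a b η := by ext w; simp [β.left_mul]
  left_right a b η := by ext w; simp

/-- The differential `d : A → Ω¹_D`, `d a = -i [D, a]`. -/
def ncDiff [Algebra ℂ 𝕜] : A →ₗ[𝕜] β.ncForms D where
  toFun a := algebraMap ℂ 𝕜 (-Complex.I) • ⟨β.comm D a, β.comm_mem D a⟩
  map_add' a b := by
    rw [← smul_add]; congr 1; ext w; simp [comm]; abel
  map_smul' k a := by
    rw [RingHom.id_apply, smul_comm]; congr 1; ext w; simp [comm, smul_sub]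

end Bimod

end Algebra

section Deformation

variable (E : Type*) [NormedAddCommGroup E] [NormedSpace ℝ E]
  (M : Type*) [TopologicalSpace M] [ChartedSpace E M]
  (𝕜 : Type*) [CommRing 𝕜] [Algebra ℂ 𝕜]
  (A : Type*) [NonUnitalRing A] [Module 𝕜 A] [Module ℂ A] [IsScalarTower ℂ 𝕜 A]
  [IsScalarTower 𝕜 A A] [SMulCommClass 𝕜 A A]

/-- A smooth deformation (to second order) of the manifold `M`: a (possibly non-unital)
`𝕜`-algebra `A` over a commutative `ℂ`-algebra `𝕜` with an element `κ ∈ 𝕜` and an isomorphism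
`A/κA ≅ C_c^∞(M)` such that `A/κ³A` is a free `ℂ[κ]/κ³`-module. The isomorphism is given by the
corresponding reduction modulo `κ`, a surjective homomorphism `A → C_c^∞(M)` with kernel `κA`. -/
structure SmoothDeformation where
  κ : 𝕜
  red : A →ₙₐ[ℂ] Cc E M
  red_surjective : Function.Surjective red
  red_eq_zero_iff : ∀ a, red a = 0 ↔ ∃ b : A, a = κ • b
  free : IsFreeToSecondOrder κ A

variable {E M 𝕜 A}

/-- A bimodule deformation of the vector bundle `V`: an `A`-bimodule `W` with a bimodule
isomorphism `W/κW ≅ Γ_c(M, V)` (given by the reduction `W → Γ_c(M, V)` modulo `κ`) such that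
`W/κ³W` is a free `ℂ[κ]/κ³`-module. -/
structure BimoduleDeformation (𝔻 : SmoothDeformation E M 𝕜 A)
    (F : Type*) [NormedAddCommGroup F] [NormedSpace ℝ F] [NormedSpace ℂ F] [IsScalarTower ℝ ℂ F]
    (V : M → Type*) [TopologicalSpace (Bundle.TotalSpace F V)] [∀ x, TopologicalSpace (V x)]
    [FiberBundle F V] [∀ x, AddCommGroup (V x)] [∀ x, Module ℂ (V x)] [IsComplexBundle F V]
    [∀ x, Module ℝ (V x)] [VectorBundle ℝ F V]
    {W : Type*} [AddCommGroup W] [Module 𝕜 W] [Module ℂ W] [IsScalarTower ℂ 𝕜 W]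
    (β : Bimod 𝕜 A W) where
  red : W →ₗ[ℂ] Gc (E := E) F V
  red_surjective : Function.Surjective red
  red_eq_zero_iff : ∀ w, red w = 0 ↔ ∃ u : W, w = 𝔻.κ • u
  red_left : ∀ a w, red (β.left a w) = 𝔻.red a • red w
  red_right : ∀ a w, red (β.right a w) = 𝔻.red a • red w
  free : IsFreeToSecondOrder 𝔻.κ W

variable [IsManifold 𝓘(ℝ, E) ∞ M] [T2Space M]

/-- A deformation of one-forms: a bimodule deformation of the cotangent bundle together with a
derivation `d : A → Ω` that reduces to the gradient operator modulo `κ`. -/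
structure OneFormDeformation (𝔻 : SmoothDeformation E M 𝕜 A)
    {Ω : Type*} [AddCommGroup Ω] [Module 𝕜 Ω] [Module ℂ Ω] [IsScalarTower ℂ 𝕜 Ω]
    (β : Bimod 𝕜 A Ω) (d : A →ₗ[𝕜] Ω) extends
    BimoduleDeformation 𝔻 (E →L[ℝ] ℂ) (CotC E (M := M)) β where
  d_mul : ∀ a b, d (a * b) = β.right b (d a) + β.left a (d b)
  red_d : ∀ a, red (d a) = grad (𝔻.red a)

/-- A deformed spectral triple `(A, W, D)` for the pseudo-Riemannian manifold `(M, g)`, where `W`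
deforms the Spin bundle `V` with Clifford representation `c`. -/
structure DeformedSpectralTriple [FiniteDimensional ℝ E] {g : PseudoRiemannianMetric E M}
    {F : Type*} [NormedAddCommGroup F] [NormedSpace ℝ F] [NormedSpace ℂ F] [IsScalarTower ℝ ℂ F]
    {V : M → Type*} [TopologicalSpace (Bundle.TotalSpace F V)] [∀ x, TopologicalSpace (V x)]
    [FiberBundle F V] [∀ x, AddCommGroup (V x)] [∀ x, Module ℂ (V x)] [IsComplexBundle F V]
    [∀ x, Module ℝ (V x)] [VectorBundle ℝ F V] (c : CliffordRepresentation g F V)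
    (𝕜 : Type*) [CommRing 𝕜] [Algebra ℂ 𝕜]
    (A : Type*) [NonUnitalRing A] [Module 𝕜 A] [Module ℂ A] [IsScalarTower ℂ 𝕜 A]
    [IsScalarTower 𝕜 A A] [SMulCommClass 𝕜 A A]
    (W : Type*) [AddCommGroup W] [Module 𝕜 W] [Module ℂ W] [IsScalarTower ℂ 𝕜 W] where
  deformation : SmoothDeformation E M 𝕜 A
  bimod : Bimod 𝕜 A W
  spinors : BimoduleDeformation deformation F V bimod
  D : W →ₗ[𝕜] W
  dirac : ∃ D₀ : Gc (E := E) F V →ₗ[ℂ] Gc (E := E) F V,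
    c.IsDiracType D₀ ∧ ∀ w, spinors.red (D w) = D₀ (spinors.red w)
  comm_right : ∀ a b w,
    bimod.comm D a (bimod.right b w) = bimod.right b (bimod.comm D a w)
  forms : OneFormDeformation deformation (bimod.ncBimod D) (bimod.ncDiff D)

/-- `π` is the bivector field of the Poisson bracket determined by the deformation:
`κ {f, g} = i [a, b] mod κ²` whenever `f = a mod κ` and `g = b mod κ`. -/
def SmoothDeformation.Determines (𝔻 : SmoothDeformation E M 𝕜 A) (π : BivectorField E M) : Prop :=
  ∀ a b c : A, 𝔻.red c = π.bracket (𝔻.red a) (𝔻.red b) →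
    ∃ r : A, Complex.I • (a * b - b * a) - 𝔻.κ • c = 𝔻.κ ^ 2 • r

/-- `𝒟` is the contravariant connection determined by the bimodule deformation:
`𝒟_{df} v = {f, v}`, where `κ {f, v} = i [a, w] mod κ²` whenever `f = a mod κ` and
`v = w mod κ`. -/
def BimoduleDeformation.Determines {𝔻 : SmoothDeformation E M 𝕜 A}
    {F : Type*} [NormedAddCommGroup F] [NormedSpace ℝ F] [NormedSpace ℂ F] [IsScalarTower ℝ ℂ F]
    {V : M → Type*} [TopologicalSpace (Bundle.TotalSpace F V)] [∀ x, TopologicalSpace (V x)]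
    [FiberBundle F V] [∀ x, AddCommGroup (V x)] [∀ x, Module ℂ (V x)] [IsComplexBundle F V]
    [∀ x, Module ℝ (V x)] [VectorBundle ℝ F V]
    {W : Type*} [AddCommGroup W] [Module 𝕜 W] [Module ℂ W] [IsScalarTower ℂ 𝕜 W]
    {β : Bimod 𝕜 A W} (𝕍 : BimoduleDeformation 𝔻 F V β) {π : BivectorField E M}
    (𝒟 : ContravariantConnection π F V) : Prop :=
  ∀ (a : A) (w u : W), 𝕍.red u = 𝒟.op (grad (𝔻.red a)) (𝕍.red w) →
    ∃ r : W, Complex.I • (β.left a w - β.right a w) - 𝔻.κ • u = 𝔻.κ ^ 2 • r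

end Deformation

end DeformedGeometry

end

open DeformedGeometry

/-! The whole theorem is commutator algebra to second order in κ, transported to geometry by the
fact that a derivation at a point sees only the differential there.

Algebra. A commutator `a w - w a` vanishes modulo κ because left and right actions agree there, so
`i (a w - w a) / κ` makes sense modulo κ once division by κ does. Freeness of `W/κ³W` supplies two
forms of cancellation: κ u = κ v modulo κ² gives u = v modulo κ, so the brackets are well defined;
κ² u = 0 gives u = 0 modulo κ, so identities between double commutators descend to double brackets.
The Leibniz and Jacobi identities of commutators then become Leibniz rules in both arguments and
`{f,{h,v}} - {h,{f,v}} = {{f,h},v}` (`BimodReduction.bracket_bracket`). This is the Jacobi identity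
when the bimodule is `A`, and flatness on exact forms in general. Torsion vanishes on exact forms
because `d(ab - ba) = [a, db] - [b, da]`.

Geometry. By Hadamard's lemma `{f,v}` at x depends on f only through `df` at x
(`pointDerivation_eq_zero`), so the brackets extend to covectors; smoothness of the extension, and
every reduction to exact forms, rests on each compactly supported one-form being a finite sum of
forms `f dh` (`mem_exactSpan`).

Metric. Elements of `Ω¹_D` reduce to Clifford multiplication (`red_apply`) and commute with the
right action (`apply_right`). Hence for η, θ lifting σ, ρ, the operator `Q = ηθ + θη` reduces to
multiplication by `2 g(σ,ρ)`. The Leibniz rule gives `i[a,Q]/κ` as `2 g({f,σ},ρ) + 2 g(σ,{f,ρ})`. On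
the other hand `Q` equals the left action of a lift b of `2 g(σ,ρ)` plus κP, and P commutes with a
modulo κ because Q commutes with the right action; so `i[a,Q]/κ` is also `{f, 2 g(σ,ρ)}`
(`red_eq_bracket_smul`). -/

noncomputable section

set_option linter.unusedSectionVars false

namespace DeformedGeometry

/-! ### Smooth parametric integrals and Hadamard's lemma -/

section Hadamard

variable {E : Type*} [NormedAddCommGroup E] [NormedSpace ℝ E] [FiniteDimensional ℝ E]

/-- The integral over `[0, 1]` of a smooth function depending smoothly on a parameter is smooth. -/
theorem contDiff_integral_of_contDiff_uncurry {G : E → ℝ → ℂ}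
    (hG : ContDiff ℝ ∞ (Function.uncurry G)) :
    ContDiff ℝ ∞ fun x => ∫ t in (0 : ℝ)..1, G x t := by
  rw [contDiff_infty]
  intro n
  induction n generalizing G with
  | zero =>
    rw [Nat.cast_zero, contDiff_zero]
    exact intervalIntegral.continuous_parametric_intervalIntegral_of_continuous' hG.continuous _ _
  | succ n ih =>
    have hG' : ContDiff ℝ ∞ (fun p : E × ℝ => fderiv ℝ (fun y => G y p.2) p.1) := by
      refine ContDiff.fderiv (m := ∞) (n := ∞) (f := fun (p : E × ℝ) y => G y p.2) ?_ contDiff_fst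
        (by simp)
      exact hG.comp (contDiff_snd.prodMk (contDiff_snd.comp contDiff_fst))
    have hd : ∀ t, Differentiable ℝ (fun y => G y t) := fun t =>
      (hG.comp (contDiff_id.prodMk contDiff_const)).differentiable (by simp)
    have key : ∀ x₀, HasFDerivAt (fun x => ∫ t in (0 : ℝ)..1, G x t)
        (∫ t in (0 : ℝ)..1, fderiv ℝ (fun y => G y t) x₀) x₀ := by
      intro x₀
      -- In finite dimension the unit ball is compact, so the derivative is dominated there by a
      -- constant.
      obtain ⟨C, hC⟩ := ((isCompact_closedBall x₀ 1).prod
        (isCompact_Icc (a := (0 : ℝ)) (b := 1))).exists_bound_of_continuousOn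
        hG'.continuous.continuousOn
      refine intervalIntegral.hasFDerivAt_integral_of_dominated_of_fderiv_le
        (F' := fun x t => fderiv ℝ (fun y => G y t) x) (bound := fun _ => C)
        (Metric.closedBall_mem_nhds x₀ one_pos) ?_ ?_ ?_ ?_ ?_ ?_
      · refine Filter.Eventually.of_forall fun x => Continuous.aestronglyMeasurable ?_
        exact hG.continuous.comp (continuous_const.prodMk continuous_id)
      · exact Continuous.intervalIntegrable
          (hG.continuous.comp (continuous_const.prodMk continuous_id)) _ _
      · refine Continuous.aestronglyMeasurable ?_
        exact hG'.continuous.comp (continuous_const.prodMk continuous_id)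
      · refine Filter.Eventually.of_forall fun t ht x hx => hC (x, t) ⟨hx, ?_⟩
        rw [Set.uIoc_of_le zero_le_one] at ht
        exact ⟨ht.1.le, ht.2⟩
      · exact intervalIntegrable_const
      · exact Filter.Eventually.of_forall fun t _ x _ => (hd t x).hasFDerivAt
    -- Testing the derivative on fixed vectors keeps the integrand complex valued, so the induction
    -- hypothesis applies to it.
    rw [Nat.cast_succ, contDiff_succ_iff_fderiv_apply]
    refine ⟨fun x => (key x).differentiableAt, by simp, fun v => ?_⟩
    have h : (fun x => fderiv ℝ (fun x => ∫ t in (0 : ℝ)..1, G x t) x v) =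
        fun x => ∫ t in (0 : ℝ)..1, fderiv ℝ (fun y => G y t) x v := by
      ext x
      rw [(key x).fderiv, ContinuousLinearMap.intervalIntegral_apply]
      exact (hG'.continuous.comp (continuous_const.prodMk continuous_id)).intervalIntegrable _ _
    rw [h]
    exact ih (G := fun x t => fderiv ℝ (fun y => G y t) x v) (hG'.clm_apply contDiff_const)

/-- Hadamard's lemma. -/
theorem hadamard_lemma {φ : E → ℂ} (hφ : ContDiff ℝ ∞ φ) {ι : Type*} [Fintype ι]
    (b : Module.Basis ι ℝ E) (z : E) :
    ∃ h : ι → E → ℂ, (∀ i, ContDiff ℝ ∞ (h i)) ∧ (∀ i, h i z = fderiv ℝ φ z (b i)) ∧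
      ∀ y, φ y = φ z + ∑ i, (b.repr (y - z) i : ℂ) * h i y := by
  have hφ' : ContDiff ℝ ∞ (fderiv ℝ φ) := hφ.fderiv_right (by simp)
  have hG : ContDiff ℝ ∞ (fun p : E × ℝ => fderiv ℝ φ (z + p.2 • (p.1 - z))) :=
    hφ'.comp (by fun_prop)
  refine ⟨fun i y => ∫ t in (0 : ℝ)..1, fderiv ℝ φ (z + t • (y - z)) (b i), fun i => ?_,
    fun i => by simp, fun y => ?_⟩
  · exact contDiff_integral_of_contDiff_uncurry
      (G := fun y t => fderiv ℝ φ (z + t • (y - z)) (b i)) (hG.clm_apply contDiff_const)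
  · have hc : Continuous fun t : ℝ => fderiv ℝ φ (z + t • (y - z)) :=
      hφ'.continuous.comp (by fun_prop)
    have hd : ∀ t : ℝ, HasDerivAt (fun t : ℝ => φ (z + t • (y - z)))
        (fderiv ℝ φ (z + t • (y - z)) (y - z)) t := fun t => by
      have h1 : HasDerivAt (fun t : ℝ => z + t • (y - z)) (y - z) t := by
        simpa using ((hasDerivAt_id t).smul_const (y - z)).const_add z
      exact ((hφ.differentiable (by simp) _).hasFDerivAt).comp_hasDerivAt t h1
    have hI := intervalIntegral.integral_eq_sub_of_hasDerivAt (fun t _ => hd t)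
      ((hc.clm_apply continuous_const).intervalIntegrable 0 1)
    simp only [one_smul, add_sub_cancel, zero_smul, add_zero] at hI
    rw [← sub_eq_iff_eq_add', ← hI]
    have hs : ∀ L : E →L[ℝ] ℂ, L (y - z) = ∑ i, (b.repr (y - z) i : ℂ) * L (b i) := fun L => by
      conv_lhs => rw [← b.sum_repr (y - z)]
      rw [map_sum]
      exact Finset.sum_congr rfl fun i _ => by rw [map_smul, Complex.real_smul]
    simp_rw [hs]
    rw [intervalIntegral.integral_finsetSum]
    · simp
    · intro i _
      exact (continuous_const.mul (hc.clm_apply continuous_const)).intervalIntegrable 0 1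

end Hadamard

/-! ### Pointwise rules for functions and sections -/

section Action

variable {E : Type*} [NormedAddCommGroup E] [NormedSpace ℝ E]
  {M : Type*} [TopologicalSpace M] [ChartedSpace E M]
  {F : Type*} [NormedAddCommGroup F] [NormedSpace ℝ F] [NormedSpace ℂ F]
  [IsScalarTower ℝ ℂ F]
  {V : M → Type*} [TopologicalSpace (Bundle.TotalSpace F V)] [∀ x, TopologicalSpace (V x)]
  [FiberBundle F V] [∀ x, AddCommGroup (V x)] [∀ x, Module ℂ (V x)] [IsComplexBundle F V]
  [∀ x, Module ℝ (V x)] [VectorBundle ℝ F V]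

theorem Cc.ext {f h : Cc E M} (H : ∀ x, f.1 x = h.1 x) : f = h := Subtype.ext (funext H)

theorem Gc.ext {s t : Gc (E := E) F V} (H : ∀ x, s.1 x = t.1 x) : s = t := Subtype.ext (funext H)

theorem Cc.mul_apply (f h : Cc E M) (x : M) : (f * h).1 x = f.1 x * h.1 x := rfl
theorem Cc.add_apply (f h : Cc E M) (x : M) : (f + h).1 x = f.1 x + h.1 x := rfl
theorem Cc.sub_apply (f h : Cc E M) (x : M) : (f - h).1 x = f.1 x - h.1 x := rfl
theorem Cc.neg_apply (f : Cc E M) (x : M) : (-f).1 x = -f.1 x := rfl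
theorem Cc.smul_apply (z : ℂ) (f : Cc E M) (x : M) : (z • f).1 x = z * f.1 x := rfl
theorem Cc.mul_comm (f h : Cc E M) : f * h = h * f := Cc.ext fun _ => _root_.mul_comm _ _

theorem Gc.fun_smul_apply (f : Cc E M) (s : Gc (E := E) F V) (x : M) :
    (f • s).1 x = f.1 x • s.1 x := rfl
theorem Gc.add_apply (s t : Gc (E := E) F V) (x : M) : (s + t).1 x = s.1 x + t.1 x := rfl
theorem Gc.sub_apply (s t : Gc (E := E) F V) (x : M) : (s - t).1 x = s.1 x - t.1 x := rfl
theorem Gc.smul_apply (z : ℂ) (s : Gc (E := E) F V) (x : M) : (z • s).1 x = z • s.1 x := rfl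

theorem Gc.fun_smul_add (f : Cc E M) (s t : Gc (E := E) F V) : f • (s + t) = f • s + f • t :=
  Gc.ext fun _ => smul_add _ _ _
theorem Gc.fun_smul_sub (f : Cc E M) (s t : Gc (E := E) F V) : f • (s - t) = f • s - f • t :=
  Gc.ext fun _ => smul_sub _ _ _
theorem Gc.fun_add_smul (f h : Cc E M) (s : Gc (E := E) F V) : (f + h) • s = f • s + h • s :=
  Gc.ext fun _ => add_smul _ _ _
theorem Gc.fun_smul_smul (z : ℂ) (f : Cc E M) (s : Gc (E := E) F V) : f • z • s = z • f • s :=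
  Gc.ext fun _ => smul_comm _ _ _
theorem Gc.smul_fun_smul (z : ℂ) (f : Cc E M) (s : Gc (E := E) F V) :
    (z • f) • s = z • f • s :=
  Gc.ext fun _ => mul_smul _ _ _
theorem Gc.fun_smul_zero (f : Cc E M) : f • (0 : Gc (E := E) F V) = 0 :=
  Gc.ext fun _ => smul_zero _

end Action

/-! ### Cutoffs in charts and derivations at a point -/

section Local

variable {E : Type*} [NormedAddCommGroup E] [NormedSpace ℝ E] [FiniteDimensional ℝ E]
  {M : Type*} [TopologicalSpace M] [ChartedSpace E M] [IsManifold 𝓘(ℝ, E) ∞ M] [T2Space M]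

/-- The compactly supported function on `M` that is given near `x₀` by a smooth function of the
coordinates of the chart at `x₀`. -/
def chartLift {x₀ : M} (χ : SmoothBumpFunction 𝓘(ℝ, E) x₀) (φ : E → ℂ) (hφ : ContDiff ℝ ∞ φ) :
    Cc E M :=
  ⟨fun y => χ y • φ (extChartAt 𝓘(ℝ, E) x₀ y),
    χ.contMDiff_smul (hφ.contMDiff.comp_contMDiffOn (contMDiffOn_extChartAt)),
    χ.hasCompactSupport.smul_right⟩

theorem chartLift_eventuallyEq {x₀ : M} (χ : SmoothBumpFunction 𝓘(ℝ, E) x₀) {φ : E → ℂ}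
    (hφ : ContDiff ℝ ∞ φ) :
    (chartLift χ φ hφ).1 =ᶠ[nhds x₀] fun y => φ (extChartAt 𝓘(ℝ, E) x₀ y) := by
  filter_upwards [χ.eventuallyEq_one] with y hy
  simp [chartLift, hy]

theorem chartLift_self {x₀ : M} (χ : SmoothBumpFunction 𝓘(ℝ, E) x₀) {φ : E → ℂ}
    (hφ : ContDiff ℝ ∞ φ) :
    (chartLift χ φ hφ).1 x₀ = φ (extChartAt 𝓘(ℝ, E) x₀ x₀) :=
  (chartLift_eventuallyEq χ hφ).eq_of_nhds

theorem exists_eq_one_nhds_tsupport_subset {x₀ : M} {U : Set M} (hU : U ∈ nhds x₀) :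
    ∃ χ : Cc E M, χ.1 =ᶠ[nhds x₀] 1 ∧ tsupport χ.1 ⊆ U := by
  obtain ⟨χ, -, hχ⟩ := (SmoothBumpFunction.nhds_basis_tsupport (I := 𝓘(ℝ, E)) x₀).mem_iff.1 hU
  exact ⟨chartLift χ 1 contDiff_const, chartLift_eventuallyEq χ _,
    (tsupport_smul_subset_left _ _).trans hχ⟩

/-- The derivative of the chart is the tangent trivialization itself, so near the centre linear
coordinate functions have constant differentials there. These differentials serve as a local
coframe. -/
theorem grad_chartLift_eventually {x₀ : M} (χ : SmoothBumpFunction 𝓘(ℝ, E) x₀) (L : E →L[ℝ] ℂ) :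
    ∀ᶠ y in nhds x₀, ∀ v, (grad (chartLift χ L L.contDiff)).1 y v =
      L ((trivializationAt E (TangentSpace 𝓘(ℝ, E)) x₀).continuousLinearMapAt ℝ y v) := by
  filter_upwards [(chartLift_eventuallyEq χ L.contDiff).eventuallyEq_nhds,
    (chartAt E x₀).open_source.mem_nhds (mem_chart_source E x₀)] with y hy hs v
  have h1 : HasMFDerivAt 𝓘(ℝ, E) 𝓘(ℝ, E) (extChartAt 𝓘(ℝ, E) x₀) y _ :=
    (mdifferentiableAt_extChartAt hs).hasMFDerivAt
  have h2 := (L.hasMFDerivAt (x := extChartAt 𝓘(ℝ, E) x₀ y)).comp y h1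
  rw [TangentBundle.continuousLinearMapAt_trivializationAt hs]
  exact (congrArg (fun L => L v) (hy.mfderiv_eq (I := 𝓘(ℝ, E)) (I' := 𝓘(ℝ, ℂ)))).trans
    (congrArg (fun L => L v) h2.mfderiv)

theorem exists_grad_eq (x₀ : M) (α : CotC E x₀) : ∃ f : Cc E M, (grad f).1 x₀ = α := by
  obtain ⟨χ⟩ : Nonempty (SmoothBumpFunction 𝓘(ℝ, E) x₀) := inferInstance
  let e := trivializationAt E (TangentSpace 𝓘(ℝ, E)) x₀
  let L : E →L[ℝ] ℂ := ContinuousLinearMap.comp α (e.symmL ℝ x₀)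
  refine ⟨chartLift χ L L.contDiff, ?_⟩
  ext v
  refine ((grad_chartLift_eventually χ L).self_of_nhds v).trans ?_
  exact congrArg α (e.symmL_continuousLinearMapAt
    (FiberBundle.mem_baseSet_trivializationAt E (TangentSpace 𝓘(ℝ, E)) x₀) v)

omit [T2Space M] in
/-- The representative in the chart at `x₀` of a function, cut off to the chart domain. -/
theorem contDiff_bump_smul_comp_symm {x₀ : M} (χ : SmoothBumpFunction 𝓘(ℝ, E) x₀) (f : Cc E M) :
    ContDiff ℝ ∞ fun y => χ.toContDiffBump y • f.1 ((extChartAt 𝓘(ℝ, E) x₀).symm y) := by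
  rw [contDiff_iff_contDiffAt]
  intro y
  by_cases hy : y ∈ (extChartAt 𝓘(ℝ, E) x₀).target
  · refine χ.toContDiffBump.contDiff.contDiffAt.smul ?_
    have h : ContMDiffOn 𝓘(ℝ, E) 𝓘(ℝ, ℂ) ∞ (fun y => f.1 ((extChartAt 𝓘(ℝ, E) x₀).symm y))
        (extChartAt 𝓘(ℝ, E) x₀).target := f.2.1.comp_contMDiffOn (contMDiffOn_extChartAt_symm x₀)
    exact (contMDiffOn_iff_contDiffOn.1 h).contDiffAt ((isOpen_extChartAt_target x₀).mem_nhds hy)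
  · have h : y ∉ tsupport χ.toContDiffBump := fun h => hy <| by
      rw [χ.toContDiffBump.tsupport_eq] at h
      exact χ.closedBall_subset ⟨h, by simp⟩
    refine (contDiffAt_const (c := (0 : ℂ))).congr_of_eventuallyEq ?_
    filter_upwards [(isClosed_tsupport _).isOpen_compl.mem_nhds h] with z hz
    rw [image_eq_zero_of_notMem_tsupport hz, zero_smul]

/-- A derivation at a point kills every function whose differential vanishes there. -/
theorem pointDerivation_eq_zero {U : Type*} [AddCommGroup U] [Module ℂ U] {x₀ : M}
    (δ : Cc E M →ₗ[ℂ] U) (hδ : ∀ f h, δ (f * h) = f.1 x₀ • δ h + h.1 x₀ • δ f) {f : Cc E M}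
    (hf : (grad f).1 x₀ = 0) : δ f = 0 := by
  obtain ⟨χ⟩ : Nonempty (SmoothBumpFunction 𝓘(ℝ, E) x₀) := inferInstance
  have hloc : ∀ k : Cc E M, k.1 =ᶠ[nhds x₀] 0 → δ k = 0 := fun k hk => by
    -- Locality: with ψ equal to 1 at x₀ and supported where k vanishes, the Leibniz rule applied to
    -- ψk = 0 leaves only δ k.
    obtain ⟨ψ, hψ, hsub⟩ := exists_eq_one_nhds_tsupport_subset (E := E) hk
    have h0 : ψ * k = 0 := Cc.ext fun y => by
      by_cases hy : y ∈ tsupport ψ.1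
      · have : k.1 y = 0 := hsub hy
        simp [Cc.mul_apply, this]
      · simp [Cc.mul_apply, image_eq_zero_of_notMem_tsupport hy]
    have h1 := hδ ψ k
    have h2 : k.1 x₀ = 0 := hk.eq_of_nhds
    have h3 : ψ.1 x₀ = 1 := hψ.eq_of_nhds
    rw [h0, map_zero, h2, h3] at h1
    simpa using h1.symm
  set z := extChartAt 𝓘(ℝ, E) x₀ x₀ with hz
  -- The cutoff makes the representative smooth on all of `E`, so the segments in Hadamard's lemma
  -- stay in its domain.
  set φ : E → ℂ := fun y => χ.toContDiffBump y • f.1 ((extChartAt 𝓘(ℝ, E) x₀).symm y) with hφdef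
  have hφ : ContDiff ℝ ∞ φ := contDiff_bump_smul_comp_symm χ f
  have hφz : φ =ᶠ[nhds z] fun y => f.1 ((extChartAt 𝓘(ℝ, E) x₀).symm y) := by
    filter_upwards [χ.toContDiffBump.eventuallyEq_one] with y hy
    simp only [hφdef]
    rw [hy]
    exact one_smul _ _
  have hdφ : fderiv ℝ φ z = 0 := by
    rw [hφz.fderiv_eq]
    have hd := (f.2.1 x₀).mdifferentiableAt (by simp)
    ext v
    have := congrArg (fun L : CotC E x₀ => L v) hf
    change mfderiv 𝓘(ℝ, E) 𝓘(ℝ, ℂ) f.1 x₀ v = 0 at this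
    have h9 : fderivWithin ℝ (writtenInExtChartAt 𝓘(ℝ, E) 𝓘(ℝ, ℂ) x₀ f.1)
        (Set.range 𝓘(ℝ, E)) (extChartAt 𝓘(ℝ, E) x₀ x₀) v = 0 :=
      (congrArg (fun L => L v) hd.mfderiv).symm.trans this
    rw [ModelWithCorners.range_eq_univ, fderivWithin_univ] at h9
    exact h9
  let b := Module.finBasis ℝ E
  obtain ⟨h, hh, hhz, hφh⟩ := hadamard_lemma hφ b z
  have hu : ∀ i, ContDiff ℝ ∞ fun y => (b.repr (y - z) i : ℂ) := fun i => by
    have : ContDiff ℝ ∞ (LinearMap.toContinuousLinearMap (b.coord i)) :=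
      ContinuousLinearMap.contDiff _
    exact Complex.ofRealCLM.contDiff.comp (this.comp (contDiff_id.sub contDiff_const))
  let one : Cc E M := chartLift χ 1 contDiff_const
  let u := fun i => chartLift χ _ (hu i)
  let w := fun i => chartLift χ _ (hh i)
  have hone : one.1 =ᶠ[nhds x₀] 1 := chartLift_eventuallyEq χ _
  have hone' : one.1 x₀ = 1 := hone.eq_of_nhds
  -- The algebra has no unit; a bump that is locally 1 is locally idempotent, which is enough.
  have hδone : δ one = 0 := by
    have h1 : δ (one * one - one) = 0 := hloc _ <| by
      filter_upwards [hone] with y hy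
      simp [Cc.sub_apply, Cc.mul_apply, hy]
    rw [map_sub, hδ, hone'] at h1
    simpa using h1
  -- Locally f is a constant plus products `u i * w i`. The coordinates `u i` vanish at x₀, and so
  -- do the `w i`, being partial derivatives of f there, so δ kills each product.
  have hdecomp : δ (f - (f.1 x₀ • one + ∑ i, u i * w i)) = 0 := by
    refine hloc _ ?_
    have hcont : Filter.Tendsto (extChartAt 𝓘(ℝ, E) x₀) (nhds x₀) (nhds z) :=
      continuousAt_extChartAt x₀
    filter_upwards [hone, Filter.eventually_all.2 fun i => chartLift_eventuallyEq χ (hu i),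
      Filter.eventually_all.2 fun i => chartLift_eventuallyEq χ (hh i), hcont.eventually hφz,
      extChartAt_source_mem_nhds (I := 𝓘(ℝ, E)) x₀] with y h1 h2 h3 h4 h5
    have hsum : (∑ i, u i * w i : Cc E M).1 y = ∑ i, (u i).1 y * (w i).1 y := by
      rw [show (∑ i, u i * w i : Cc E M).1 = ∑ i, (u i * w i).1 from
        map_sum (NonUnitalSubalgebra.toSubmodule (Cc E M)).subtype _ _, Finset.sum_apply]
      rfl
    rw [(extChartAt 𝓘(ℝ, E) x₀).left_inv h5] at h4
    have h6 : φ z = f.1 x₀ := by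
      rw [hφz.eq_of_nhds, hz, extChartAt_to_inv]
    have h7 := hφh (extChartAt 𝓘(ℝ, E) x₀ y)
    rw [h4, h6] at h7
    rw [Cc.sub_apply, Cc.add_apply, hsum, Cc.smul_apply, h1]
    simp only [u, w, h2, h3]
    rw [h7]
    simp
  have hu0 : ∀ i, (u i).1 x₀ = 0 := fun i => by
    rw [chartLift_self]; simp [z]
  have hw0 : ∀ i, (w i).1 x₀ = 0 := fun i => by
    rw [chartLift_self, ← hz, hhz, hdφ]; rfl
  rw [map_sub, map_add, map_smul, hδone, map_sum] at hdecomp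
  simpa [hδ, hu0, hw0] using hdecomp

/-- A derivation at a point depends only on the differential there. -/
theorem pointDerivation_congr {U : Type*} [AddCommGroup U] [Module ℂ U] {x₀ : M}
    (δ : Cc E M →ₗ[ℂ] U) (hδ : ∀ f h, δ (f * h) = f.1 x₀ • δ h + h.1 x₀ • δ f) {f h : Cc E M}
    (hf : (grad f).1 x₀ = (grad h).1 x₀) : δ f = δ h := by
  rw [← sub_eq_zero, ← map_sub]
  refine pointDerivation_eq_zero δ hδ ?_
  rw [map_sub, Gc.sub_apply, hf, sub_self]

end Local

/-! ### One-forms as finite sums of forms `f dh` -/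

section Span

variable {E : Type*} [NormedAddCommGroup E] [NormedSpace ℝ E] [FiniteDimensional ℝ E]
  {M : Type*} [TopologicalSpace M] [ChartedSpace E M] [IsManifold 𝓘(ℝ, E) ∞ M] [T2Space M]

variable (E M) in
/-- The one-forms that are finite sums of forms `f dh`. -/
def exactSpan : AddSubmonoid (Omc E M) :=
  AddSubmonoid.closure (Set.range fun p : Cc E M × Cc E M => p.1 • grad p.2)

omit [FiniteDimensional ℝ E] [T2Space M] in
theorem smul_grad_mem_exactSpan (f h : Cc E M) : f • grad h ∈ exactSpan E M :=
  AddSubmonoid.subset_closure ⟨(f, h), rfl⟩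

omit [FiniteDimensional ℝ E] [T2Space M] in
/-- The components of a one-form with respect to the chart at `x₀` are smooth on the chart. -/
theorem contMDiffOn_component (x₀ : M) (σ : Omc E M) (w : E) :
    ContMDiffOn 𝓘(ℝ, E) 𝓘(ℝ, ℂ) ∞
      (fun y => σ.1 y ((trivializationAt E (TangentSpace 𝓘(ℝ, E)) x₀).symmL ℝ y w))
      (chartAt E x₀).source := by
  let e₁ := trivializationAt E (TangentSpace 𝓘(ℝ, E)) x₀
  let e₂ := trivializationAt ℂ (Bundle.Trivial M ℂ) x₀
  let e := Bundle.Trivialization.continuousLinearMap (RingHom.id ℝ) e₁ e₂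
  have hbase : e.baseSet = (chartAt E x₀).source := by
    simp [e, e₁, e₂, Bundle.Trivialization.baseSet_continuousLinearMap]
  have key : ∀ y, (e ⟨y, σ.1 y⟩).2 w = σ.1 y (e₁.symmL ℝ y w) := fun y => by
    rw [Bundle.Trivialization.continuousLinearMap_apply]
    simp [e₂]
  intro y hy
  have h := (e.contMDiffAt_section_iff (IB := 𝓘(ℝ, E)) (n := ∞) (hbase ▸ hy)).1 (σ.2.1 y)
  have h2 := h.clm_apply (contMDiffAt_const (c := w))
  exact (h2.congr_of_eventuallyEq (Filter.Eventually.of_forall fun y => (key y).symm)).contMDiffWithinAt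

theorem exists_smul_mem_exactSpan (x₀ : M) :
    ∃ ψ : Cc E M, ψ.1 =ᶠ[nhds x₀] 1 ∧ ∀ σ : Omc E M, ψ • σ ∈ exactSpan E M := by
  obtain ⟨χ₀⟩ : Nonempty (SmoothBumpFunction 𝓘(ℝ, E) x₀) := inferInstance
  let b := Module.finBasis ℝ E
  let e := trivializationAt E (TangentSpace 𝓘(ℝ, E)) x₀
  let L := fun i => Complex.ofRealCLM.comp (LinearMap.toContinuousLinearMap (b.coord i))
  have hnear : ∀ᶠ y in nhds x₀, (∀ i v, (grad (chartLift χ₀ (L i) (L i).contDiff)).1 y v =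
      L i (e.continuousLinearMapAt ℝ y v)) ∧ y ∈ e.baseSet :=
    (Filter.eventually_all.2 fun i => grad_chartLift_eventually χ₀ (L i)).and
      (e.open_baseSet.mem_nhds (FiberBundle.mem_baseSet_trivializationAt E _ x₀))
  -- A second bump, supported where the coordinate functions cut off by `χ₀` still have the
  -- coordinate differentials.
  obtain ⟨χ, -, hχ⟩ := (SmoothBumpFunction.nhds_basis_tsupport (I := 𝓘(ℝ, E)) x₀).mem_iff.1 hnear
  refine ⟨chartLift χ 1 contDiff_const, chartLift_eventuallyEq χ _, fun σ => ?_⟩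
  let s : Fin _ → Cc E M := fun i => ⟨fun y => χ y • σ.1 y (e.symmL ℝ y (b i)),
    χ.contMDiff_smul (contMDiffOn_component x₀ σ (b i)), χ.hasCompactSupport.smul_right⟩
  have hsum : chartLift χ 1 contDiff_const • σ =
      ∑ i, s i • grad (chartLift χ₀ (L i) (L i).contDiff) := by
    refine Gc.ext fun y => ?_
    have hval : (∑ i, s i • grad (chartLift χ₀ (L i) (L i).contDiff)).1 y =
        ∑ i, (s i).1 y • (grad (chartLift χ₀ (L i) (L i).contDiff)).1 y := by
      rw [show (∑ i, s i • grad (chartLift χ₀ (L i) (L i).contDiff)).1 = _ from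
        map_sum (Omc E M).subtype _ _, Finset.sum_apply]
      rfl
    rw [hval, Gc.fun_smul_apply]
    by_cases hy : y ∈ tsupport χ
    · obtain ⟨h1, h2⟩ := hχ hy
      ext v
      have hv : v = ∑ i, b.repr (e.continuousLinearMapAt ℝ y v) i • e.symmL ℝ y (b i) := by
        conv_lhs => rw [← e.symmL_continuousLinearMapAt (R := ℝ) h2 v,
          ← b.sum_repr (e.continuousLinearMapAt ℝ y v), map_sum]
        exact Finset.sum_congr rfl fun i _ => map_smul _ _ _
      have h3 : σ.1 y v = ∑ i, (b.repr (e.continuousLinearMapAt ℝ y v) i) •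
          σ.1 y (e.symmL ℝ y (b i)) := by
        conv_lhs => rw [hv, map_sum]
        exact Finset.sum_congr rfl fun i _ => map_smul _ _ _
      have h4 : (∑ i, (s i).1 y • (grad (chartLift χ₀ (L i) (L i).contDiff)).1 y) v =
          ∑ i, (s i).1 y * L i (e.continuousLinearMapAt ℝ y v) := by
        rw [sum_apply]
        exact Finset.sum_congr rfl fun i _ => congrArg ((s i).1 y * ·) (h1 i v)
      refine Eq.trans ?_ h4.symm
      change (χ y • (1 : ℂ)) * σ.1 y v = _
      rw [h3, Finset.mul_sum]
      refine Finset.sum_congr rfl fun i _ => ?_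
      change (χ y • (1 : ℂ)) * (((b.repr (e.continuousLinearMapAt ℝ y v) i : ℝ) : ℂ) *
          σ.1 y (e.symmL ℝ y (b i))) =
        ((χ y : ℂ) * σ.1 y (e.symmL ℝ y (b i))) *
          ((b.repr (e.continuousLinearMapAt ℝ y v) i : ℝ) : ℂ)
      rw [Complex.real_smul]
      ring
    · have h0 : χ y = 0 := image_eq_zero_of_notMem_tsupport hy
      rw [show (chartLift χ (1 : E → ℂ) contDiff_const).1 y = 0 by simp [chartLift, h0]]
      refine (zero_smul ℂ (σ.1 y)).trans (Finset.sum_eq_zero fun i _ => ?_).symm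
      rw [show (s i).1 y = 0 from by change χ y • _ = _; rw [h0, zero_smul]]
      exact zero_smul ℂ ((grad (chartLift χ₀ (L i) (L i).contDiff)).1 y)
  rw [hsum]
  exact sum_mem fun i _ => smul_grad_mem_exactSpan _ _

/-- Every compactly supported one-form is a finite sum of forms `f dh`. -/
theorem mem_exactSpan (σ : Omc E M) : σ ∈ exactSpan E M := by
  obtain ⟨K, hK, hσK⟩ := σ.2.2
  -- Every form can be made to vanish on s by subtracting an element of the span. The last clause
  -- says that existing zeros survive, so that corrections on two sets can be made in succession and
  -- the support stays in `K`.
  let P : Set M → Prop := fun s => ∀ σ : Omc E M, ∃ τ ρ : Omc E M, ρ ∈ exactSpan E M ∧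
    σ = ρ + τ ∧ (∀ x ∈ s, τ.1 x = 0) ∧ ∀ x, σ.1 x = 0 → τ.1 x = 0
  have hP : P K := by
    refine hK.induction_on (p := P) ?_ ?_ ?_ ?_
    · exact fun σ => ⟨σ, 0, zero_mem _, (zero_add _).symm, by simp, fun _ h => h⟩
    · intro s t hst ht σ
      obtain ⟨τ, ρ, h1, h2, h3, h4⟩ := ht σ
      exact ⟨τ, ρ, h1, h2, fun x hx => h3 x (hst hx), h4⟩
    · intro s t hs ht σ
      obtain ⟨τ, ρ, h1, h2, h3, h4⟩ := hs σ
      obtain ⟨τ', ρ', h1', h2', h3', h4'⟩ := ht τ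
      refine ⟨τ', ρ + ρ', add_mem h1 h1', by rw [h2, h2', add_assoc], ?_, fun x hx => h4' x (h4 x hx)⟩
      rintro x (hx | hx)
      exacts [h4' x (h3 x hx), h3' x hx]
    · intro x _
      obtain ⟨ψ, hψ, hmem⟩ := exists_smul_mem_exactSpan (E := E) x
      refine ⟨{y | ψ.1 y = 1}, mem_nhdsWithin_of_mem_nhds hψ, fun σ =>
        ⟨σ - ψ • σ, ψ • σ, hmem σ, by abel, fun y hy => ?_, fun y hy => ?_⟩⟩
      · rw [Gc.sub_apply, Gc.fun_smul_apply, show ψ.1 y = 1 from hy, one_smul, sub_self]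
      · rw [Gc.sub_apply, Gc.fun_smul_apply, hy, smul_zero, sub_self]
  obtain ⟨τ, ρ, h1, h2, h3, h4⟩ := hP σ
  have h0 : τ = 0 := Gc.ext fun x => by
    by_cases hx : x ∈ K
    exacts [h3 x hx, h4 x (hσK x hx)]
  rw [h2, h0, add_zero]
  exact h1

/-- To prove an additive property of one-forms it suffices to consider forms `f dh`. -/
theorem Omc.induction {P : Omc E M → Prop} (smul_grad : ∀ f h : Cc E M, P (f • grad h))
    (add : ∀ σ ρ, P σ → P ρ → P (σ + ρ)) (σ : Omc E M) : P σ := by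
  refine AddSubmonoid.closure_induction (motive := fun σ _ => P σ) ?_ ?_
    (fun σ ρ _ _ => add σ ρ) (mem_exactSpan σ)
  · rintro _ ⟨p, rfl⟩
    exact smul_grad _ _
  · have : (0 : Omc E M) = (0 : Cc E M) • grad 0 := Gc.ext fun x => (zero_smul ℂ ((grad (0 : Cc E M)).1 x)).symm
    rw [this]
    exact smul_grad _ _

end Span

/-! ### Sections with prescribed local behaviour -/

section Sections

variable {E : Type*} [NormedAddCommGroup E] [NormedSpace ℝ E] [FiniteDimensional ℝ E]
  {M : Type*} [TopologicalSpace M] [ChartedSpace E M] [IsManifold 𝓘(ℝ, E) ∞ M] [T2Space M]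
  {F : Type*} [NormedAddCommGroup F] [NormedSpace ℝ F] [NormedSpace ℂ F]
  [IsScalarTower ℝ ℂ F]
  {V : M → Type*} [TopologicalSpace (Bundle.TotalSpace F V)] [∀ x, TopologicalSpace (V x)]
  [FiberBundle F V] [∀ x, AddCommGroup (V x)] [∀ x, Module ℂ (V x)] [IsComplexBundle F V]
  [∀ x, Module ℝ (V x)] [VectorBundle ℝ F V] [ContMDiffVectorBundle ∞ F V 𝓘(ℝ, E)]

variable (F V) in
/-- There are compactly supported sections that are constant near a point in a local
trivialization. -/
theorem exists_section_eventually_constant (x₀ : M) (u : F) :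
    ∃ s : Gc (E := E) F V, ∀ᶠ y in nhds x₀, y ∈ (trivializationAt F V x₀).baseSet ∧
      (trivializationAt F V x₀ ⟨y, s.1 y⟩).2 = u := by
  let e := trivializationAt F V x₀
  have hx₀ : x₀ ∈ e.baseSet := FiberBundle.mem_baseSet_trivializationAt F V x₀
  obtain ⟨χ, hχ, hsub⟩ := exists_eq_one_nhds_tsupport_subset (E := E)
    (e.open_baseSet.mem_nhds hx₀)
  have hval : ∀ y ∈ e.baseSet, (e ⟨y, χ.1 y • e.symm y u⟩).2 = χ.1 y • u := fun y hy => by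
    rw [IsComplexBundle.map_smul (F := F) (V := V) e y hy, e.apply_mk_symm hy]
  refine ⟨⟨fun y => χ.1 y • e.symm y u, fun y => ?_, tsupport χ.1, χ.2.2, fun y hy => ?_⟩, ?_⟩
  · by_cases hy : y ∈ tsupport χ.1
    · rw [e.contMDiffAt_section_iff (hsub hy)]
      have hsm : ContMDiffAt 𝓘(ℝ, E) 𝓘(ℝ, F) ∞ (fun y => χ.1 y • u) y := by
        have hb : ContDiff ℝ ∞ (fun z : ℂ => z • u) :=
          ((ContinuousLinearMap.lsmul ℝ ℂ : ℂ →L[ℝ] F →L[ℝ] F).flip u).contDiff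
        exact hb.contMDiff.contMDiffAt.comp y (χ.2.1 y)
      refine hsm.congr_of_eventuallyEq ?_
      filter_upwards [e.open_baseSet.mem_nhds (hsub hy)] with z hz using hval z hz
    · refine (Bundle.contMDiff_zeroSection ℝ V y).congr_of_eventuallyEq ?_
      filter_upwards [(isClosed_tsupport χ.1).isOpen_compl.mem_nhds hy] with z hz
      simp [image_eq_zero_of_notMem_tsupport hz, Bundle.zeroSection]
  · simp [image_eq_zero_of_notMem_tsupport hy]
  · filter_upwards [e.open_baseSet.mem_nhds hx₀, hχ] with y hy h1
    refine ⟨hy, (hval y hy).trans ?_⟩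
    rw [h1]
    exact one_smul ℂ u

variable (F V) in
/-- A bundle with non-trivial fibre has a section that does not vanish at a given point. -/
theorem exists_section_ne_zero [Nontrivial F] (x₀ : M) : ∃ s : Gc (E := E) F V, s.1 x₀ ≠ 0 := by
  obtain ⟨u, hu⟩ := exists_ne (0 : F)
  obtain ⟨s, hs⟩ := exists_section_eventually_constant (E := E) F V x₀ u
  refine ⟨s, fun h => hu ?_⟩
  obtain ⟨h1, h2⟩ := hs.self_of_nhds
  -- Complex linearity with scalar 0 shows that the trivialization sends zero to zero, contradicting
  -- u ≠ 0.
  have h3 := IsComplexBundle.map_smul (F := F) (V := V) (trivializationAt F V x₀) x₀ h1 0 0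
  rw [← h2, h]
  simpa using h3

variable (F V) in
/-- A function is smooth if its product with every section of a non-trivial bundle is smooth. -/
theorem contMDiff_of_smul_section [FiniteDimensional ℂ F] [Nontrivial F] {f : M → ℂ}
    (H : ∀ s : Gc (E := E) F V, (fun x => f x • s.1 x) ∈ Gc (E := E) F V) :
    ContMDiff 𝓘(ℝ, E) 𝓘(ℝ, ℂ) ∞ f := by
  intro x₀
  obtain ⟨u, hu⟩ := exists_ne (0 : F)
  obtain ⟨ℓ, hℓ⟩ := Module.Projective.exists_dual_ne_zero ℂ hu
  obtain ⟨s, hs⟩ := exists_section_eventually_constant (E := E) F V x₀ u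
  have h := Bundle.contMDiffAt_section _ |>.1 ((H s).1 x₀)
  -- Normalised to take the value 1 on u, so it recovers f from the local coordinates of f s.
  let ℓ' : F →L[ℝ] ℂ := (LinearMap.toContinuousLinearMap ((ℓ u)⁻¹ • ℓ)).restrictScalars ℝ
  refine (ℓ'.contMDiff.contMDiffAt.comp x₀ h).congr_of_eventuallyEq ?_
  filter_upwards [hs] with y ⟨h1, h2⟩
  change f y = ℓ' (trivializationAt F V x₀ ⟨y, f y • s.1 y⟩).2
  rw [IsComplexBundle.map_smul (F := F) (V := V) _ y h1, h2]
  change f y = (ℓ u)⁻¹ * ℓ (f y • u)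
  rw [map_smul, smul_eq_mul]
  field_simp

end Sections

/-! ### Cancelling powers of κ by freeness to second order -/

section Torsion

/-- After lifting to the domain `ℂ[X]`, the factor `X ^ k` cancels from divisibility by `X ^ (k +
l)`. -/
theorem truncatedPolynomial_exists_eq {k l : ℕ} (hkl : k + l = 3)
    (r : ℂ[X] ⧸ Ideal.span {(Polynomial.X : ℂ[X]) ^ 3})
    (h : Ideal.Quotient.mk _ Polynomial.X ^ k * r = 0) :
    ∃ s, r = Ideal.Quotient.mk _ Polynomial.X ^ l * s := by
  obtain ⟨p, rfl⟩ := Ideal.Quotient.mk_surjective r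
  rw [← map_pow, ← map_mul, Ideal.Quotient.eq_zero_iff_mem, Ideal.mem_span_singleton, ← hkl,
    pow_add] at h
  obtain ⟨q, rfl⟩ := (mul_dvd_mul_iff_left (pow_ne_zero k Polynomial.X_ne_zero)).1 h
  exact ⟨Ideal.Quotient.mk _ q, by rw [map_mul, map_pow]⟩

theorem free_exists_eq {N : Type*} [AddCommGroup N]
    [Module (ℂ[X] ⧸ Ideal.span {(Polynomial.X : ℂ[X]) ^ 3}) N]
    [Module.Free (ℂ[X] ⧸ Ideal.span {(Polynomial.X : ℂ[X]) ^ 3}) N] {k l : ℕ} (hkl : k + l = 3)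
    (n : N) (h : (Ideal.Quotient.mk (Ideal.span {(Polynomial.X : ℂ[X]) ^ 3}) Polynomial.X) ^ k • n = 0) :
    ∃ m : N, n = (Ideal.Quotient.mk (Ideal.span {(Polynomial.X : ℂ[X]) ^ 3}) Polynomial.X) ^ l • m := by
  let b := Module.Free.chooseBasis (ℂ[X] ⧸ Ideal.span {(Polynomial.X : ℂ[X]) ^ 3}) N
  have h1 : ∀ i, ∃ s, b.repr n i = Ideal.Quotient.mk _ Polynomial.X ^ l * s := fun i =>
    truncatedPolynomial_exists_eq hkl _ <| by
      have := congrArg (fun m => b.repr m i) h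
      simpa using this
  choose s hs using h1
  refine ⟨∑ i ∈ (b.repr n).support, s i • b i, ?_⟩
  conv_lhs => rw [← b.linearCombination_repr n, Finsupp.linearCombination_apply, Finsupp.sum]
  rw [Finset.smul_sum]
  exact Finset.sum_congr rfl fun i _ => by rw [hs i, mul_smul]

variable {𝕜 : Type*} [CommRing 𝕜] [Algebra ℂ 𝕜] {W : Type*} [AddCommGroup W] [Module 𝕜 W] {κ : 𝕜}

theorem IsFreeToSecondOrder.exists_eq (hW : IsFreeToSecondOrder κ W) {k l : ℕ} (hkl : k + l = 3)
    {w u : W} (h : κ ^ k • w = κ ^ 3 • u) : ∃ v, w = κ ^ l • v := by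
  let _ : Module (ℂ[X] ⧸ Ideal.span {(Polynomial.X : ℂ[X]) ^ 3})
      (W ⧸ (Ideal.span {κ ^ 3} • ⊤ : Submodule 𝕜 W)) := Module.compHom _ (truncation κ)
  have : Module.Free (ℂ[X] ⧸ Ideal.span {(Polynomial.X : ℂ[X]) ^ 3})
      (W ⧸ (Ideal.span {κ ^ 3} • ⊤ : Submodule 𝕜 W)) := hW
  have hX : ∀ (j : ℕ) (x : W),
      (Ideal.Quotient.mk (Ideal.span {(Polynomial.X : ℂ[X]) ^ 3}) Polynomial.X) ^ j •
        (Submodule.Quotient.mk x : W ⧸ (Ideal.span {κ ^ 3} • ⊤ : Submodule 𝕜 W)) =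
      Submodule.Quotient.mk (κ ^ j • x) := fun j x => by
    change truncation κ (Ideal.Quotient.mk _ Polynomial.X ^ j) •
      (Submodule.Quotient.mk x : W ⧸ (Ideal.span {κ ^ 3} • ⊤ : Submodule 𝕜 W)) = _
    have : truncation κ (Ideal.Quotient.mk _ Polynomial.X ^ j) = Ideal.Quotient.mk _ (κ ^ j) := by
      rw [map_pow, truncation, Ideal.quotientMap_mk, map_pow]
      simp
    rw [this]
    rfl
  have hmem : ∀ x : W, x ∈ (Ideal.span {κ ^ 3} • ⊤ : Submodule 𝕜 W) ↔ ∃ y, κ ^ 3 • y = x := by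
    intro x
    rw [Submodule.ideal_span_singleton_smul, Submodule.mem_smul_pointwise_iff_exists]
    simp
  obtain ⟨m, hm⟩ := free_exists_eq hkl
    (Submodule.Quotient.mk w : W ⧸ (Ideal.span {κ ^ 3} • ⊤ : Submodule 𝕜 W)) (by
      rw [hX, Submodule.Quotient.mk_eq_zero, hmem]
      exact ⟨u, h.symm⟩)
  obtain ⟨v, rfl⟩ := Submodule.Quotient.mk_surjective _ m
  rw [hX, Submodule.Quotient.eq, hmem] at hm
  obtain ⟨y, hy⟩ := hm
  -- The quotient gives w only up to `κ ^ 3 • y`, which is itself `κ ^ l` times `κ ^ k • y`.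
  refine ⟨v + κ ^ k • y, ?_⟩
  rw [smul_add, smul_smul, ← pow_add, add_comm l k, hkl, hy]
  abel

/-- κ annihilates w - κ u, which therefore lies in κ²W. This makes a quotient by κ well defined
modulo κ even when the dividend is known only modulo κ². -/
theorem IsFreeToSecondOrder.exists_eq_smul (hW : IsFreeToSecondOrder κ W) {w u : W}
    (h : κ • w = κ ^ 2 • u) : ∃ v, w = κ • v := by
  obtain ⟨v, hv⟩ := hW.exists_eq (k := 1) (l := 2) rfl (w := w - κ • u) (u := 0) (by
    rw [pow_one, smul_sub, h, smul_smul, sq, sub_self, smul_zero])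
  refine ⟨u + κ • v, ?_⟩
  rw [smul_add, smul_smul, ← sq, ← hv]
  abel

/-- The case k = 2, l = 1. Relations between iterated brackets appear with a factor κ², and this
removes it. -/
theorem IsFreeToSecondOrder.exists_eq_smul_of_sq_smul (hW : IsFreeToSecondOrder κ W) {w : W}
    (h : κ ^ 2 • w = 0) : ∃ v, w = κ • v := by
  obtain ⟨v, hv⟩ := hW.exists_eq (k := 2) (l := 1) rfl (w := w) (u := 0) (by rw [h, smul_zero])
  exact ⟨v, by rwa [pow_one] at hv⟩

end Torsion

/-! ### Brackets from commutators modulo κ² -/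

section Bracket

variable {𝕜 : Type*} [CommRing 𝕜] [Algebra ℂ 𝕜]
  {A : Type*} [NonUnitalRing A] [Module 𝕜 A] [Module ℂ A] [IsScalarTower ℂ 𝕜 A]
  {W : Type*} [AddCommGroup W] [Module 𝕜 W] [Module ℂ W] [IsScalarTower ℂ 𝕜 W]
  {C : Type*} [AddCommGroup C] [Module ℂ C] {G : Type*} [AddCommGroup G] [Module ℂ G]
  {κ : 𝕜}

/-- A reduction modulo `κ` of a `𝕜`-module that is free to second order. -/
structure Reduction (κ : 𝕜) (W : Type*) [AddCommGroup W] [Module 𝕜 W] [Module ℂ W]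
    [IsScalarTower ℂ 𝕜 W] (G : Type*) [AddCommGroup G] [Module ℂ G] where
  red : W →ₗ[ℂ] G
  red_surjective : Function.Surjective red
  red_eq_zero_iff : ∀ w, red w = 0 ↔ ∃ u : W, w = κ • u
  free : IsFreeToSecondOrder κ W

/-- A reduction modulo `κ` of a bimodule to a symmetric bimodule. -/
structure BimodReduction (ρ : Reduction κ A C) (β : Bimod 𝕜 A W) (G : Type*) [AddCommGroup G]
    [Module ℂ G] extends Reduction κ W G where
  act : C →ₗ[ℂ] G →ₗ[ℂ] G
  red_left : ∀ a w, red (β.left a w) = act (ρ.red a) (red w)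
  red_right : ∀ a w, red (β.right a w) = act (ρ.red a) (red w)

theorem Reduction.red_eq_of_smul_eq (ρ : Reduction κ W G) {u v r : W}
    (h : κ • u = κ • v + κ ^ 2 • r) : ρ.red u = ρ.red v := by
  rw [← sub_eq_zero, ← map_sub, ρ.red_eq_zero_iff]
  exact ρ.free.exists_eq_smul (u := r) (by rw [smul_sub, h]; abel)

theorem Reduction.red_eq_zero_of_sq_smul (ρ : Reduction κ W G) {u : W}
    (h : κ ^ 2 • u = 0) : ρ.red u = 0 :=
  (ρ.red_eq_zero_iff _).2 (ρ.free.exists_eq_smul_of_sq_smul h)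

namespace BimodReduction

variable {ρ : Reduction κ A C} {β : Bimod 𝕜 A W} (Y : BimodReduction ρ β G)

include Y in
theorem exists_smul_eq (a : A) (w : W) :
    ∃ u, κ • u = Complex.I • (β.left a w - β.right a w) := by
  obtain ⟨u, hu⟩ := (Y.red_eq_zero_iff (Complex.I • (β.left a w - β.right a w))).1 (by
    rw [map_smul, map_sub, Y.red_left, Y.red_right, sub_self, smul_zero])
  exact ⟨u, hu.symm⟩

/-- Changing the lifts by κ b and κ y changes the commutator by κ times `[b, w] + [a', y]`. These
commutators are again divisible by κ, so the change is of order κ² and is lost. -/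
theorem red_eq_red {a a' : A} {w w' u u' r r' : W} (ha : ρ.red a = ρ.red a')
    (hw : Y.red w = Y.red w')
    (h : κ • u = Complex.I • (β.left a w - β.right a w) + κ ^ 2 • r)
    (h' : κ • u' = Complex.I • (β.left a' w' - β.right a' w') + κ ^ 2 • r') :
    Y.red u = Y.red u' := by
  obtain ⟨b, hb⟩ := (ρ.red_eq_zero_iff (a - a')).1 (by rw [map_sub, ha, sub_self])
  obtain ⟨y, hy⟩ := (Y.red_eq_zero_iff (w - w')).1 (by rw [map_sub, hw, sub_self])
  obtain ⟨t, ht⟩ := Y.exists_smul_eq b w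
  obtain ⟨t', ht'⟩ := Y.exists_smul_eq a' y
  obtain rfl : a = a' + κ • b := by rw [← hb]; abel
  obtain rfl : w = w' + κ • y := by rw [← hy]; abel
  refine Y.red_eq_of_smul_eq (r := t + t' + r - r') ?_
  have h1 : κ ^ 2 • (t + t' + r - r') = κ • (κ • t) + κ • (κ • t') + κ ^ 2 • r - κ ^ 2 • r' := by
    simp only [smul_sub, smul_add, smul_smul, sq]
  rw [h1, ht, ht', h, h']
  simp only [map_add, map_smul, LinearMap.add_apply, LinearMap.smul_apply, smul_sub, smul_add,
    smul_comm κ Complex.I]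
  abel

/-- The bracket `{f, v}` with `κ {f, v} = i (a w - w a) mod κ²`, where `f = a` and `v = w`
modulo `κ`. -/
def bracket : C →ₗ[ℂ] G →ₗ[ℂ] G :=
  let sa := Function.surjInv ρ.red_surjective
  let sw := Function.surjInv Y.red_surjective
  have hsa : ∀ f, ρ.red (sa f) = f := Function.surjInv_eq ρ.red_surjective
  have hsw : ∀ v, Y.red (sw v) = v := Function.surjInv_eq Y.red_surjective
  let q := fun f v => (Y.exists_smul_eq (sa f) (sw v)).choose
  have hq : ∀ f v, κ • q f v = Complex.I • (β.left (sa f) (sw v) - β.right (sa f) (sw v)) :=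
    fun f v => (Y.exists_smul_eq (sa f) (sw v)).choose_spec
  -- The chosen lifts and quotients are not linear. Independence of lifts allows each linearity law
  -- to be checked on sums and multiples of the chosen ones.
  have key : ∀ f v a w u, ρ.red a = f → Y.red w = v →
      κ • u = Complex.I • (β.left a w - β.right a w) → Y.red (q f v) = Y.red u :=
    fun f v a w u ha hw hu => Y.red_eq_red (a := sa f) (a' := a) (w := sw v) (w' := w) (r := 0)
      (r' := 0) (by rw [hsa, ha]) (by rw [hsw, hw]) (by rw [hq, smul_zero, add_zero])
      (by rw [hu, smul_zero, add_zero])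
  LinearMap.mk₂ ℂ (fun f v => Y.red (q f v))
    (fun f f' v => (key _ _ (sa f + sa f') (sw v) (q f v + q f' v)
      (by rw [map_add, hsa, hsa]) (hsw _) (by
        rw [smul_add, hq, hq, ← smul_add, map_add, map_add, LinearMap.add_apply,
          LinearMap.add_apply]; congr 1; abel)).trans (map_add _ _ _))
    (fun z f v => (key _ _ (z • sa f) (sw v) (z • q f v)
      (by rw [map_smul, hsa]) (hsw _) (by
        rw [smul_comm κ z, hq, LinearMap.map_smul_of_tower, LinearMap.map_smul_of_tower,
          LinearMap.smul_apply, LinearMap.smul_apply, ← smul_sub, smul_comm z])).trans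
        (map_smul _ _ _))
    (fun f v v' => (key _ _ (sa f) (sw v + sw v') (q f v + q f v')
      (hsa _) (by rw [map_add, hsw, hsw]) (by
        rw [smul_add, hq, hq, ← smul_add, map_add, map_add]; congr 1; abel)).trans (map_add _ _ _))
    (fun z f v => (key _ _ (sa f) (z • sw v) (z • q f v)
      (hsa _) (by rw [map_smul, hsw]) (by
        rw [smul_comm κ z, hq, LinearMap.map_smul_of_tower, LinearMap.map_smul_of_tower,
          ← smul_sub, smul_comm z])).trans (map_smul _ _ _))

theorem bracket_red {a : A} {w u r : W}
    (h : κ • u = Complex.I • (β.left a w - β.right a w) + κ ^ 2 • r) :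
    Y.bracket (ρ.red a) (Y.red w) = Y.red u :=
  Y.red_eq_red (r := 0) (Function.surjInv_eq ρ.red_surjective _)
    (Function.surjInv_eq Y.red_surjective _)
    (by rw [smul_zero, add_zero]; exact (Y.exists_smul_eq _ _).choose_spec) h

theorem bracket_red' {a : A} {w u : W}
    (h : κ • u = Complex.I • (β.left a w - β.right a w)) :
    Y.bracket (ρ.red a) (Y.red w) = Y.red u :=
  Y.bracket_red (r := 0) (by rw [h, smul_zero, add_zero])

theorem exists_of_red_eq_bracket {a : A} {w u : W}
    (h : Y.red u = Y.bracket (ρ.red a) (Y.red w)) :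
    ∃ r, Complex.I • (β.left a w - β.right a w) - κ • u = κ ^ 2 • r := by
  obtain ⟨u', hu'⟩ := Y.exists_smul_eq a w
  rw [Y.bracket_red' hu', ← sub_eq_zero, ← map_sub, Y.red_eq_zero_iff] at h
  obtain ⟨r, hr⟩ := h
  refine ⟨-r, ?_⟩
  rw [← hu', ← smul_sub, sq, mul_smul, smul_neg, ← hr]
  congr 1
  abel

end BimodReduction

variable [IsScalarTower 𝕜 A A] [SMulCommClass 𝕜 A A]

variable (𝕜 A) in
/-- The algebra `A` as a bimodule over itself. -/
def Bimod.regular : Bimod 𝕜 A A where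
  left := LinearMap.mul 𝕜 A
  right := (LinearMap.mul 𝕜 A).flip
  left_mul := by simp [mul_assoc]
  right_mul := by simp [mul_assoc]
  left_right := by simp [mul_assoc]

namespace BimodReduction

variable {ρ : Reduction κ A C} {β : Bimod 𝕜 A W} (Y : BimodReduction ρ β G)
  (X : BimodReduction ρ (Bimod.regular 𝕜 A) C) (hX : ∀ a, X.red a = ρ.red a)

include hX

theorem bracket_red_red {a b e : A} (h : κ • e = Complex.I • (a * b - b * a)) :
    X.bracket (ρ.red a) (ρ.red b) = ρ.red e := by
  rw [← hX b, ← hX e]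
  exact X.bracket_red' h

theorem bracket_antisymm (f h : C) : X.bracket f h = -X.bracket h f := by
  obtain ⟨a, rfl⟩ := ρ.red_surjective f
  obtain ⟨b, rfl⟩ := ρ.red_surjective h
  obtain ⟨e, he⟩ := X.exists_smul_eq a b
  rw [X.bracket_red_red hX he, X.bracket_red_red hX (a := b) (b := a) (e := -e), map_neg, neg_neg]
  rw [smul_neg, he, ← smul_neg, neg_sub]
  rfl

/-- Reduction of `[a, b w] = [a, b] w + b [a, w]`. -/
theorem bracket_act (f h : C) (v : G) :
    Y.bracket f (Y.act h v) = Y.act (X.bracket f h) v + Y.act h (Y.bracket f v) := by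
  obtain ⟨a, rfl⟩ := ρ.red_surjective f
  obtain ⟨b, rfl⟩ := ρ.red_surjective h
  obtain ⟨w, rfl⟩ := Y.red_surjective v
  obtain ⟨e, he⟩ := X.exists_smul_eq a b
  obtain ⟨u, hu⟩ := Y.exists_smul_eq a w
  rw [X.bracket_red_red hX he, Y.bracket_red' hu, ← Y.red_left, ← Y.red_left, ← Y.red_left,
    ← map_add]
  refine Y.bracket_red' ?_
  have h1 : κ • β.left e w = β.left (κ • e) w := by rw [map_smul, LinearMap.smul_apply]
  rw [smul_add, h1, ← map_smul (β.left b), hu, he]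
  simp only [Bimod.regular, LinearMap.mul_apply', LinearMap.flip_apply,
    LinearMap.map_smul_of_tower, LinearMap.smul_apply, map_sub, LinearMap.sub_apply, β.left_mul,
    smul_sub, β.left_right]
  abel

-- Reduction of `[ab, w] = a [b, w] + [a, w] b`; the right factor b acts modulo κ as multiplication
-- by its function.
omit hX [IsScalarTower 𝕜 A A] [SMulCommClass 𝕜 A A] in
theorem bracket_red_mul (a b : A) (v : G) :
    Y.bracket (ρ.red (a * b)) v =
      Y.act (ρ.red a) (Y.bracket (ρ.red b) v) + Y.act (ρ.red b) (Y.bracket (ρ.red a) v) := by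
  obtain ⟨w, rfl⟩ := Y.red_surjective v
  obtain ⟨u, hu⟩ := Y.exists_smul_eq a w
  obtain ⟨u', hu'⟩ := Y.exists_smul_eq b w
  rw [Y.bracket_red' hu, Y.bracket_red' hu', ← Y.red_left, ← Y.red_right, ← map_add]
  refine Y.bracket_red' ?_
  rw [smul_add, ← map_smul, ← map_smul, hu, hu']
  simp only [LinearMap.map_smul_of_tower, map_sub, β.left_mul, β.right_mul, smul_sub,
    β.left_right]
  abel

/-- The Jacobi identity for commutators holds exactly, but computes κ² times the difference of the
two sides; second-order freeness is what allows κ² to be cancelled. -/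
theorem bracket_bracket (f h : C) (v : G) :
    Y.bracket f (Y.bracket h v) - Y.bracket h (Y.bracket f v) = Y.bracket (X.bracket f h) v := by
  obtain ⟨a, rfl⟩ := ρ.red_surjective f
  obtain ⟨b, rfl⟩ := ρ.red_surjective h
  obtain ⟨w, rfl⟩ := Y.red_surjective v
  obtain ⟨e, he⟩ := X.exists_smul_eq a b
  obtain ⟨u, hu⟩ := Y.exists_smul_eq b w
  obtain ⟨u', hu'⟩ := Y.exists_smul_eq a w
  obtain ⟨p, hp⟩ := Y.exists_smul_eq a u
  obtain ⟨q, hq⟩ := Y.exists_smul_eq b u'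
  obtain ⟨s, hs⟩ := Y.exists_smul_eq e w
  rw [X.bracket_red_red hX he, Y.bracket_red' hu, Y.bracket_red' hu', Y.bracket_red' hp,
    Y.bracket_red' hq, Y.bracket_red' hs, ← map_sub, ← sub_eq_zero, ← map_sub]
  refine Y.red_eq_zero_of_sq_smul ?_
  have h1 : ∀ (c : A) (x : W), κ • (β.left c x - β.right c x) =
      β.left c (κ • x) - β.right c (κ • x) := fun c x => by rw [map_smul, map_smul, smul_sub]
  have h2 : κ • (β.left e w - β.right e w) = β.left (κ • e) w - β.right (κ • e) w := by
    rw [map_smul, map_smul, LinearMap.smul_apply, LinearMap.smul_apply, smul_sub]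
  have h3 : κ ^ 2 • (p - q - s) = κ • (κ • p) - κ • (κ • q) - κ • (κ • s) := by
    simp only [smul_sub, smul_smul, sq]
  rw [h3, hp, hq, hs, smul_comm κ Complex.I, smul_comm κ Complex.I, smul_comm κ Complex.I, h1, h1,
    h2, hu, hu', he]
  simp only [Bimod.regular, LinearMap.mul_apply', LinearMap.flip_apply,
    LinearMap.map_smul_of_tower, LinearMap.smul_apply, map_sub, LinearMap.sub_apply, β.left_mul,
    β.right_mul, smul_sub, β.left_right]
  abel

end BimodReduction

end Bracket

/-! ### Evaluation and multiplication as linear maps -/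

section Pointwise

variable {E : Type*} [NormedAddCommGroup E] [NormedSpace ℝ E]
  {M : Type*} [TopologicalSpace M] [ChartedSpace E M]
  (F : Type*) [NormedAddCommGroup F] [NormedSpace ℝ F] [NormedSpace ℂ F]
  [IsScalarTower ℝ ℂ F]
  (V : M → Type*) [TopologicalSpace (Bundle.TotalSpace F V)] [∀ x, TopologicalSpace (V x)]
  [FiberBundle F V] [∀ x, AddCommGroup (V x)] [∀ x, Module ℂ (V x)] [IsComplexBundle F V]
  [∀ x, Module ℝ (V x)] [VectorBundle ℝ F V]

variable (E) in
/-- Evaluation of functions at a point. -/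
def Cc.eval (x : M) : Cc E M →ₗ[ℂ] ℂ where
  toFun f := f.1 x
  map_add' _ _ := rfl
  map_smul' _ _ := rfl

/-- Evaluation of sections at a point. -/
def Gc.eval (x : M) : Gc (E := E) F V →ₗ[ℂ] V x where
  toFun s := s.1 x
  map_add' _ _ := rfl
  map_smul' _ _ := rfl

/-- Multiplication of sections by functions as a bilinear map. -/
def Gc.funSMul : Cc E M →ₗ[ℂ] Gc (E := E) F V →ₗ[ℂ] Gc (E := E) F V :=
  LinearMap.mk₂ ℂ (fun f s => f • s) Gc.fun_add_smul Gc.smul_fun_smul Gc.fun_smul_add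
    fun z f s => Gc.fun_smul_smul z f s

end Pointwise

/-! ### From brackets with functions to operators along one-forms -/

section Extension

variable {E : Type*} [NormedAddCommGroup E] [NormedSpace ℝ E] [FiniteDimensional ℝ E]
  {M : Type*} [TopologicalSpace M] [ChartedSpace E M] [IsManifold 𝓘(ℝ, E) ∞ M] [T2Space M]
  {F : Type*} [NormedAddCommGroup F] [NormedSpace ℝ F] [NormedSpace ℂ F]
  [IsScalarTower ℝ ℂ F]
  {V : M → Type*} [TopologicalSpace (Bundle.TotalSpace F V)] [∀ x, TopologicalSpace (V x)]
  [FiberBundle F V] [∀ x, AddCommGroup (V x)] [∀ x, Module ℂ (V x)] [IsComplexBundle F V]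
  [∀ x, Module ℝ (V x)] [VectorBundle ℝ F V]

/-- A function with prescribed differential at a point. -/
def potential {x : M} (α : CotC E x) : Cc E M := (exists_grad_eq x α).choose

@[simp]
theorem grad_potential {x : M} (α : CotC E x) : (grad (potential α)).1 x = α :=
  (exists_grad_eq x α).choose_spec

/-- For fixed v and x, the value at x is a derivation at x in the first argument. This makes the
extension independent of the chosen potentials. -/
theorem bilinear_apply_congr {br : Cc E M →ₗ[ℂ] Gc (E := E) F V →ₗ[ℂ] Gc (E := E) F V}
    (hbr : ∀ f h v, br (f * h) v = f • br h v + h • br f v) {x : M} {f h : Cc E M}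
    (H : (grad f).1 x = (grad h).1 x) (v : Gc (E := E) F V) : (br f v).1 x = (br h v).1 x :=
  pointDerivation_congr (Gc.eval F V x ∘ₗ br.flip v)
    (fun f h => congrArg (fun s : Gc (E := E) F V => s.1 x) (hbr f h v)) H

/-- The extension of an operation `(f, v) ↦ {f, v}` that is a derivation in `f` to one-forms. -/
def extendDerivation (br : Cc E M →ₗ[ℂ] Gc (E := E) F V →ₗ[ℂ] Gc (E := E) F V)
    (hbr : ∀ f h v, br (f * h) v = f • br h v + h • br f v) :
    Omc E M →ₗ[ℂ] Gc (E := E) F V →ₗ[ℂ] Gc (E := E) F V :=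
  -- The potentials are chosen independently at each point, so smoothness is not visible from the
  -- formula. On `f dh` the result is f times the section `br h v`, and such forms span.
  have hmem : ∀ (σ : Omc E M) v, (fun x => (br (potential (σ.1 x)) v).1 x) ∈ Gc (E := E) F V := by
    intro σ v
    induction σ using Omc.induction with
    | smul_grad f h =>
      convert (f • br h v).2 using 1
      ext x
      rw [bilinear_apply_congr hbr (h := f.1 x • h) (by
        rw [grad_potential, map_smul]; rfl), map_smul]
      rfl
    | add σ ρ hσ hρ =>
      convert add_mem hσ hρ using 1
      ext x
      rw [bilinear_apply_congr hbr (h := potential (σ.1 x) + potential (ρ.1 x)) (by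
        rw [grad_potential, map_add, Gc.add_apply, Gc.add_apply, grad_potential,
          grad_potential]), map_add]
      rfl
  LinearMap.mk₂ ℂ (fun σ v => ⟨_, hmem σ v⟩)
    (fun σ ρ v => Gc.ext fun x => by
      refine (bilinear_apply_congr hbr (h := potential (σ.1 x) + potential (ρ.1 x)) (by
        rw [grad_potential, map_add, Gc.add_apply, Gc.add_apply, grad_potential,
          grad_potential]) v).trans ?_
      rw [map_add]
      rfl)
    (fun z σ v => Gc.ext fun x => by
      refine (bilinear_apply_congr hbr (h := z • potential (σ.1 x)) (by
        rw [grad_potential, map_smul, Gc.smul_apply, Gc.smul_apply, grad_potential]) v).trans ?_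
      rw [map_smul]
      rfl)
    (fun σ v w => Gc.ext fun x => by
      have h := congrArg (Gc.eval F V x) (map_add (br (potential (σ.1 x))) v w)
      exact h)
    (fun z σ v => Gc.ext fun x => by
      have h := congrArg (Gc.eval F V x) (map_smul (br (potential (σ.1 x))) z v)
      exact h)

variable {br : Cc E M →ₗ[ℂ] Gc (E := E) F V →ₗ[ℂ] Gc (E := E) F V}
    (hbr : ∀ f h v, br (f * h) v = f • br h v + h • br f v)

theorem extendDerivation_apply {σ : Omc E M} {x : M} {h : Cc E M} (H : (grad h).1 x = σ.1 x)
    (v : Gc (E := E) F V) : (extendDerivation br hbr σ v).1 x = (br h v).1 x :=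
  bilinear_apply_congr hbr (by rw [grad_potential, H]) v

theorem extendDerivation_grad (h : Cc E M) (v : Gc (E := E) F V) :
    extendDerivation br hbr (grad h) v = br h v :=
  Gc.ext fun _ => extendDerivation_apply hbr rfl v

theorem extendDerivation_smul (f : Cc E M) (σ : Omc E M) (v : Gc (E := E) F V) :
    extendDerivation br hbr (f • σ) v = f • extendDerivation br hbr σ v := by
  refine Gc.ext fun x => ?_
  rw [extendDerivation_apply hbr (h := f.1 x • potential (σ.1 x)) (by
    rw [map_smul, Gc.smul_apply, grad_potential]; rfl), map_smul, Gc.fun_smul_apply,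
    extendDerivation_apply hbr (h := potential (σ.1 x)) (grad_potential _)]
  rfl

end Extension

/-! ### Bivector fields, Koszul brackets and reduction to exact forms -/

section Bivector

variable {E : Type*} [NormedAddCommGroup E] [NormedSpace ℝ E] [FiniteDimensional ℝ E]
  {M : Type*} [TopologicalSpace M] [ChartedSpace E M] [IsManifold 𝓘(ℝ, E) ∞ M] [T2Space M]

theorem biderivation_apply_congr {br : Cc E M →ₗ[ℂ] Cc E M →ₗ[ℂ] Cc E M}
    (hanti : ∀ f h, br f h = -br h f)
    (hbr : ∀ f h k, br f (h * k) = br f h * k + h * br f k) {x : M} {f f' h h' : Cc E M}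
    (Hf : (grad f).1 x = (grad f').1 x) (Hh : (grad h).1 x = (grad h').1 x) :
    (br f h).1 x = (br f' h').1 x := by
  have key : ∀ (f : Cc E M) {h h' : Cc E M}, (grad h).1 x = (grad h').1 x →
      (br f h).1 x = (br f h').1 x := fun f h h' H =>
    pointDerivation_congr (Cc.eval E x ∘ₗ br f) (fun h k => by
      change (br f (h * k)).1 x = h.1 x * (br f k).1 x + k.1 x * (br f h).1 x
      rw [hbr, Cc.add_apply, Cc.mul_apply, Cc.mul_apply]
      ring) H
  rw [key f Hh, hanti, hanti f', Cc.neg_apply, Cc.neg_apply, key h' Hf]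

/-- The bivector field of an antisymmetric biderivation. -/
def bivectorOfBiderivation (br : Cc E M →ₗ[ℂ] Cc E M →ₗ[ℂ] Cc E M)
    (hanti : ∀ f h, br f h = -br h f)
    (hbr : ∀ f h k, br f (h * k) = br f h * k + h * br f k) : BivectorField E M :=
  have hc := fun {x : M} {f f' h h' : Cc E M} =>
    biderivation_apply_congr (x := x) (f := f) (f' := f') (h := h) (h' := h') hanti hbr
  { toFun := fun x => LinearMap.mk₂ ℂ (fun α β => (br (potential α) (potential β)).1 x)
      (fun α α' β => (hc (f' := potential α + potential α') (by
        rw [grad_potential, map_add, Gc.add_apply, grad_potential, grad_potential]) rfl).trans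
          (by rw [map_add]; rfl))
      (fun z α β => (hc (f' := z • potential α) (by
        rw [grad_potential, map_smul, Gc.smul_apply, grad_potential]) rfl).trans
          (by rw [map_smul]; rfl))
      (fun α β β' => (hc (h' := potential β + potential β') rfl (by
        rw [grad_potential, map_add, Gc.add_apply, grad_potential, grad_potential])).trans
          (by rw [map_add]; rfl))
      (fun z α β => (hc (h' := z • potential β) rfl (by
        rw [grad_potential, map_smul, Gc.smul_apply, grad_potential])).trans
          (by rw [map_smul]; rfl))
    alt := fun x α => self_eq_neg.1
      (congrArg (fun f : Cc E M => f.1 x) (hanti (potential α) (potential α)))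
    smooth := fun σ ρ => by
      -- Agreement with a compactly supported smooth function is additive in each argument, which
      -- suits induction over forms `f dh`.
      suffices h : ∃ t : Cc E M, ∀ x, t.1 x = (br (potential (σ.1 x)) (potential (ρ.1 x))).1 x by
        obtain ⟨t, ht⟩ := h
        exact (funext ht : t.1 = _) ▸ t.2.1
      induction σ using Omc.induction with
      | add σ σ' hσ hσ' =>
        obtain ⟨t, ht⟩ := hσ
        obtain ⟨t', ht'⟩ := hσ'
        refine ⟨t + t', fun x => ?_⟩
        rw [Cc.add_apply, ht, ht', hc (f := potential ((σ + σ').1 x))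
          (f' := potential (σ.1 x) + potential (σ'.1 x)) (by
            rw [grad_potential, map_add, Gc.add_apply, Gc.add_apply, grad_potential,
              grad_potential]) rfl, map_add]
        rfl
      | smul_grad f h =>
        induction ρ using Omc.induction with
        | add σ σ' hσ hσ' =>
          obtain ⟨t, ht⟩ := hσ
          obtain ⟨t', ht'⟩ := hσ'
          refine ⟨t + t', fun x => ?_⟩
          rw [Cc.add_apply, ht, ht', hc (h := potential ((σ + σ').1 x))
            (h' := potential (σ.1 x) + potential (σ'.1 x)) rfl (by
              rw [grad_potential, map_add, Gc.add_apply, Gc.add_apply, grad_potential,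
                grad_potential]), map_add]
          rfl
        | smul_grad f' h' =>
          refine ⟨f' * (f * br h h'), fun x => ?_⟩
          rw [hc (f' := f.1 x • h) (h' := f'.1 x • h') (by
            rw [grad_potential, map_smul]; rfl) (by rw [grad_potential, map_smul]; rfl),
            map_smul, map_smul]
          rfl }

theorem bivectorOfBiderivation_bracket {br : Cc E M →ₗ[ℂ] Cc E M →ₗ[ℂ] Cc E M}
    (hanti : ∀ f h, br f h = -br h f)
    (hbr : ∀ f h k, br f (h * k) = br f h * k + h * br f k) (f h : Cc E M) :
    (bivectorOfBiderivation br hanti hbr).bracket f h = br f h :=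
  Cc.ext fun _ => biderivation_apply_congr hanti hbr (grad_potential _) (grad_potential _)

theorem BivectorField.eq_of_bracket_eq {π π' : BivectorField E M}
    (H : ∀ f h, π.bracket f h = π'.bracket f h) : π = π' := by
  have h : π.toFun = π'.toFun := by
    ext x α β
    have := congrArg (fun f : Cc E M => f.1 x) (H (potential α) (potential β))
    change π.toFun x ((grad (potential α)).1 x) ((grad (potential β)).1 x) =
      π'.toFun x ((grad (potential α)).1 x) ((grad (potential β)).1 x) at this
    rwa [grad_potential, grad_potential] at this
  cases π
  cases π'
  subst h
  rfl

/-- The Leibniz rule strips the coefficient from the second argument, antisymmetry exchanges the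
arguments, and only the prescribed values on exact forms remain. -/
theorem BivectorField.IsKoszulBracket.unique {π : BivectorField E M}
    {B B' : Omc E M →ₗ[ℂ] Omc E M →ₗ[ℂ] Omc E M} (hB : π.IsKoszulBracket B)
    (hB' : π.IsKoszulBracket B') : B = B' := by
  ext1 ρ
  ext1 σ
  induction σ using Omc.induction generalizing ρ with
  | add σ σ' hσ hσ' => rw [map_add, map_add, hσ, hσ']
  | smul_grad f h =>
    rw [hB.leibniz, hB'.leibniz, hB.antisymm, hB'.antisymm]
    congr 3
    induction ρ using Omc.induction with
    | add σ σ' hσ hσ' => rw [map_add, map_add, hσ, hσ']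
    | smul_grad f h' => rw [hB.leibniz, hB'.leibniz, hB.exact_exact, hB'.exact_exact]

variable {π : BivectorField E M}

/-- The bracket of one-forms `(σ, ρ) ↦ 𝒟_σ ρ - 𝒟_ρ σ`. -/
def ContravariantConnection.formBracket (𝒟 : CotangentConnection π) :
    Omc E M →ₗ[ℂ] Omc E M →ₗ[ℂ] Omc E M :=
  LinearMap.mk₂ ℂ (fun σ ρ : Omc E M => (𝒟.op σ ρ - 𝒟.op ρ σ : Omc E M))
    (fun σ σ' ρ => Gc.ext fun x => by
      simp only [map_add, LinearMap.add_apply, Gc.sub_apply, Gc.add_apply]; abel)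
    (fun z σ ρ => Gc.ext fun x => by
      rw [map_smul, map_smul, LinearMap.smul_apply]; exact (smul_sub z _ _).symm)
    (fun σ ρ ρ' => Gc.ext fun x => by
      simp only [map_add, LinearMap.add_apply, Gc.sub_apply, Gc.add_apply]; abel)
    (fun z σ ρ => Gc.ext fun x => by
      rw [map_smul, map_smul, LinearMap.smul_apply]; exact (smul_sub z _ _).symm)

omit [FiniteDimensional ℝ E] in
theorem ContravariantConnection.formBracket_apply (𝒟 : CotangentConnection π) (σ ρ : Omc E M) :
    𝒟.formBracket σ ρ = 𝒟.op σ ρ - 𝒟.op ρ σ := rfl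

-- The Leibniz rule of the antisymmetrised connection is automatic: the first term contributes #σ(f)
-- ρ and the second is linear over functions. Only the values on exact forms need checking. This
-- yields existence of the Koszul bracket and, by its uniqueness, vanishing torsion.
omit [FiniteDimensional ℝ E] in
theorem ContravariantConnection.isKoszulBracket_formBracket (𝒟 : CotangentConnection π)
    (h𝒟 : ∀ f h : Cc E M, 𝒟.op (grad f) (grad h) - 𝒟.op (grad h) (grad f) =
      grad (π.bracket f h)) : π.IsKoszulBracket 𝒟.formBracket where
  antisymm σ ρ := by
    rw [formBracket_apply, formBracket_apply]
    exact Gc.ext fun x => (neg_sub _ _).symm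
  exact_exact f h := h𝒟 f h
  leibniz σ f ρ := by
    rw [formBracket_apply, formBracket_apply, 𝒟.leibniz, 𝒟.smul_left, Gc.fun_smul_sub]
    exact Gc.ext fun x => add_sub_assoc _ _ _

theorem ContravariantConnection.eq_of_op_grad_eq
    {F : Type*} [NormedAddCommGroup F] [NormedSpace ℝ F] [NormedSpace ℂ F] [IsScalarTower ℝ ℂ F]
    {V : M → Type*} [TopologicalSpace (Bundle.TotalSpace F V)] [∀ x, TopologicalSpace (V x)]
    [FiberBundle F V] [∀ x, AddCommGroup (V x)] [∀ x, Module ℂ (V x)] [IsComplexBundle F V]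
    [∀ x, Module ℝ (V x)] [VectorBundle ℝ F V] {𝒟 𝒟' : ContravariantConnection π F V}
    (H : ∀ f v, 𝒟.op (grad f) v = 𝒟'.op (grad f) v) : 𝒟 = 𝒟' := by
  have h : 𝒟.op = 𝒟'.op := by
    ext1 σ
    ext1 v
    induction σ using Omc.induction with
    | add σ σ' hσ hσ' => rw [map_add, map_add, LinearMap.add_apply, LinearMap.add_apply, hσ, hσ']
    | smul_grad f h => rw [𝒟.smul_left, 𝒟'.smul_left, H]
  cases 𝒟
  cases 𝒟'
  subst h
  rfl

/-- A contravariant connection is flat if its curvature vanishes on exact forms. -/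
theorem ContravariantConnection.curvature_eq_zero
    {F : Type*} [NormedAddCommGroup F] [NormedSpace ℝ F] [NormedSpace ℂ F] [IsScalarTower ℝ ℂ F]
    {V : M → Type*} [TopologicalSpace (Bundle.TotalSpace F V)] [∀ x, TopologicalSpace (V x)]
    [FiberBundle F V] [∀ x, AddCommGroup (V x)] [∀ x, Module ℂ (V x)] [IsComplexBundle F V]
    [∀ x, Module ℝ (V x)] [VectorBundle ℝ F V] (𝒟 : ContravariantConnection π F V)
    {B : Omc E M →ₗ[ℂ] Omc E M →ₗ[ℂ] Omc E M} (hB : π.IsKoszulBracket B) (v : Gc (E := E) F V)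
    (H : ∀ f h, 𝒟.curvature B (grad f) (grad h) v = 0) (σ ρ : Omc E M) :
    𝒟.curvature B σ ρ v = 0 := by
  have hanti : ∀ σ ρ, 𝒟.curvature B σ ρ v = -𝒟.curvature B ρ σ v := fun σ ρ => by
    simp only [curvature]
    have h : 𝒟.op (-B ρ σ) = -𝒟.op (B ρ σ) := by
      have := map_neg 𝒟.op (B ρ σ)
      exact this
    rw [hB.antisymm σ ρ, h, LinearMap.neg_apply]
    abel
  have hadd : ∀ σ ρ ρ', 𝒟.curvature B σ (ρ + ρ') v =
      𝒟.curvature B σ ρ v + 𝒟.curvature B σ ρ' v := fun σ ρ ρ' => by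
    simp only [curvature, map_add, LinearMap.add_apply]
    abel
  -- The terms #σ(f) 𝒟_ρ v from the Leibniz rules of 𝒟 and of the Koszul bracket cancel.
  have hsmul : ∀ σ (f : Cc E M) ρ, 𝒟.curvature B σ (f • ρ) v = f • 𝒟.curvature B σ ρ v :=
    fun σ f ρ => by
      simp only [curvature, hB.leibniz, map_add, LinearMap.add_apply, 𝒟.smul_left, 𝒟.leibniz,
        Gc.fun_smul_sub]
      abel
  induction ρ using Omc.induction with
  | add ρ ρ' hρ hρ' => rw [hadd, hρ, hρ', add_zero]
  | smul_grad f h =>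
    rw [hsmul]
    suffices h0 : 𝒟.curvature B σ (grad h) v = 0 by rw [h0, Gc.fun_smul_zero]
    rw [hanti, neg_eq_zero]
    induction σ using Omc.induction with
    | add ρ ρ' hρ hρ' => rw [hadd, hρ, hρ', add_zero]
    | smul_grad f' h' => rw [hsmul, H, Gc.fun_smul_zero]

end Bivector

/-! ### Poisson field, connection, flatness and torsion of a deformation -/

section Deformation

variable {E : Type*} [NormedAddCommGroup E] [NormedSpace ℝ E]
  {M : Type*} [TopologicalSpace M] [ChartedSpace E M]
  {𝕜 : Type*} [CommRing 𝕜] [Algebra ℂ 𝕜]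
  {A : Type*} [NonUnitalRing A] [Module 𝕜 A] [Module ℂ A] [IsScalarTower ℂ 𝕜 A]
  [IsScalarTower 𝕜 A A] [SMulCommClass 𝕜 A A]
  {F : Type*} [NormedAddCommGroup F] [NormedSpace ℝ F] [NormedSpace ℂ F]
  [IsScalarTower ℝ ℂ F]
  {V : M → Type*} [TopologicalSpace (Bundle.TotalSpace F V)] [∀ x, TopologicalSpace (V x)]
  [FiberBundle F V] [∀ x, AddCommGroup (V x)] [∀ x, Module ℂ (V x)] [IsComplexBundle F V]
  [∀ x, Module ℝ (V x)] [VectorBundle ℝ F V]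
  {W : Type*} [AddCommGroup W] [Module 𝕜 W] [Module ℂ W] [IsScalarTower ℂ 𝕜 W]

/-- The reduction `A → C_c^∞(M)` of a smooth deformation. -/
def SmoothDeformation.reduction (𝔻 : SmoothDeformation E M 𝕜 A) :
    Reduction 𝔻.κ A (Cc E M) where
  red := { toFun := 𝔻.red, map_add' := map_add 𝔻.red, map_smul' := map_smul 𝔻.red }
  red_surjective := 𝔻.red_surjective
  red_eq_zero_iff := 𝔻.red_eq_zero_iff
  free := 𝔻.free

/-- A smooth deformation as a bimodule deformation. -/
def SmoothDeformation.regular (𝔻 : SmoothDeformation E M 𝕜 A) :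
    BimodReduction 𝔻.reduction (Bimod.regular 𝕜 A) (Cc E M) where
  toReduction := 𝔻.reduction
  act := LinearMap.mul ℂ (Cc E M)
  red_left := fun a b => map_mul 𝔻.red a b
  red_right := fun a b => (map_mul 𝔻.red b a).trans (Cc.mul_comm _ _)

/-- The bracket determined by a smooth deformation. -/
def SmoothDeformation.bracket (𝔻 : SmoothDeformation E M 𝕜 A) :
    Cc E M →ₗ[ℂ] Cc E M →ₗ[ℂ] Cc E M := 𝔻.regular.bracket

theorem SmoothDeformation.bracket_antisymm (𝔻 : SmoothDeformation E M 𝕜 A) (f h : Cc E M) :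
    𝔻.bracket f h = -𝔻.bracket h f :=
  𝔻.regular.bracket_antisymm (fun _ => rfl) f h

theorem SmoothDeformation.bracket_mul (𝔻 : SmoothDeformation E M 𝕜 A) (f h k : Cc E M) :
    𝔻.bracket f (h * k) = 𝔻.bracket f h * k + h * 𝔻.bracket f k :=
  𝔻.regular.bracket_act 𝔻.regular (fun _ => rfl) f h k

theorem SmoothDeformation.bracket_bracket (𝔻 : SmoothDeformation E M 𝕜 A) (f h k : Cc E M) :
    𝔻.bracket f (𝔻.bracket h k) - 𝔻.bracket h (𝔻.bracket f k) = 𝔻.bracket (𝔻.bracket f h) k :=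
  𝔻.regular.bracket_bracket 𝔻.regular (fun _ => rfl) f h k

theorem SmoothDeformation.bracket_red (𝔻 : SmoothDeformation E M 𝕜 A) {a b e : A}
    (h : 𝔻.κ • e = Complex.I • (a * b - b * a)) :
    𝔻.bracket (𝔻.red a) (𝔻.red b) = 𝔻.red e :=
  𝔻.regular.bracket_red' h

variable {𝔻 : SmoothDeformation E M 𝕜 A} {β : Bimod 𝕜 A W}

/-- The reduction of a bimodule deformation. -/
def BimoduleDeformation.reduction (𝕍 : BimoduleDeformation 𝔻 F V β) :
    BimodReduction 𝔻.reduction β (Gc (E := E) F V) where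
  red := 𝕍.red
  red_surjective := 𝕍.red_surjective
  red_eq_zero_iff := 𝕍.red_eq_zero_iff
  free := 𝕍.free
  act := Gc.funSMul F V
  red_left := 𝕍.red_left
  red_right := 𝕍.red_right

/-- The bracket determined by a bimodule deformation. -/
def BimoduleDeformation.bracket (𝕍 : BimoduleDeformation 𝔻 F V β) :
    Cc E M →ₗ[ℂ] Gc (E := E) F V →ₗ[ℂ] Gc (E := E) F V := 𝕍.reduction.bracket

theorem BimoduleDeformation.bracket_red (𝕍 : BimoduleDeformation 𝔻 F V β) {a : A} {w u : W}
    (h : 𝔻.κ • u = Complex.I • (β.left a w - β.right a w)) :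
    𝕍.bracket (𝔻.red a) (𝕍.red w) = 𝕍.red u :=
  𝕍.reduction.bracket_red' h

theorem BimoduleDeformation.bracket_smul (𝕍 : BimoduleDeformation 𝔻 F V β) (f h : Cc E M)
    (v : Gc (E := E) F V) :
    𝕍.bracket f (h • v) = 𝔻.bracket f h • v + h • 𝕍.bracket f v :=
  𝕍.reduction.bracket_act 𝔻.regular (fun _ => rfl) f h v

theorem BimoduleDeformation.mul_bracket (𝕍 : BimoduleDeformation 𝔻 F V β) (f h : Cc E M)
    (v : Gc (E := E) F V) :
    𝕍.bracket (f * h) v = f • 𝕍.bracket h v + h • 𝕍.bracket f v := by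
  obtain ⟨a, rfl⟩ := 𝔻.red_surjective f
  obtain ⟨b, rfl⟩ := 𝔻.red_surjective h
  rw [← map_mul]
  exact 𝕍.reduction.bracket_red_mul a b v

theorem BimoduleDeformation.bracket_bracket (𝕍 : BimoduleDeformation 𝔻 F V β) (f h : Cc E M)
    (v : Gc (E := E) F V) :
    𝕍.bracket f (𝕍.bracket h v) - 𝕍.bracket h (𝕍.bracket f v) = 𝕍.bracket (𝔻.bracket f h) v :=
  𝕍.reduction.bracket_bracket 𝔻.regular (fun _ => rfl) f h v

/-- The base ring acts on the reduction of a bimodule deformation through multiplication by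
functions. -/
theorem BimoduleDeformation.red_smul_apply (𝕍 : BimoduleDeformation 𝔻 F V β) (k : 𝕜) (w : W)
    {a : A} {x : M} (ha : (𝔻.red a).1 x = 1) :
    (𝕍.red (k • w)).1 x = (𝔻.red (k • a)).1 x • (𝕍.red w).1 x := by
  -- Reduction is only ℂ-linear, so the scalar k is moved onto an element of `A`, as a (k w) = (k a)
  -- w.
  have h : 𝔻.red a • 𝕍.red (k • w) = 𝔻.red (k • a) • 𝕍.red w := by
    rw [← 𝕍.red_left, ← 𝕍.red_left, map_smul β.left, map_smul (β.left a), LinearMap.smul_apply]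
  have hx := congrArg (Gc.eval F V x) h
  change (𝔻.red a).1 x • (𝕍.red (k • w)).1 x = (𝔻.red (k • a)).1 x • (𝕍.red w).1 x at hx
  rwa [ha, one_smul] at hx

variable [IsManifold 𝓘(ℝ, E) ∞ M] [T2Space M]

theorem SmoothDeformation.determines_iff {π : BivectorField E M} :
    𝔻.Determines π ↔ ∀ f h, π.bracket f h = 𝔻.bracket f h := by
  constructor
  · intro H f h
    obtain ⟨a, rfl⟩ := 𝔻.red_surjective f
    obtain ⟨b, rfl⟩ := 𝔻.red_surjective h
    obtain ⟨e, he⟩ := 𝔻.red_surjective (π.bracket (𝔻.red a) (𝔻.red b))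
    obtain ⟨r, hr⟩ := H a b e he
    rw [← he]
    refine (𝔻.regular.bracket_red (a := a) (w := b) (u := e) (r := -r) ?_).symm
    rw [smul_neg, ← hr]
    change _ = Complex.I • (a * b - b * a) + _
    abel
  · intro H a b e he
    exact 𝔻.regular.exists_of_red_eq_bracket (he.trans (H _ _))

theorem BimoduleDeformation.determines_iff (𝕍 : BimoduleDeformation 𝔻 F V β)
    {π : BivectorField E M} {𝒟 : ContravariantConnection π F V} :
    𝕍.Determines 𝒟 ↔ ∀ f v, 𝒟.op (grad f) v = 𝕍.bracket f v := by
  constructor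
  · intro H f v
    obtain ⟨a, rfl⟩ := 𝔻.red_surjective f
    obtain ⟨w, rfl⟩ := 𝕍.red_surjective v
    obtain ⟨u, hu⟩ := 𝕍.red_surjective (𝒟.op (grad (𝔻.red a)) (𝕍.red w))
    obtain ⟨r, hr⟩ := H a w u hu
    rw [← hu]
    refine (𝕍.reduction.bracket_red (a := a) (w := w) (u := u) (r := -r) ?_).symm
    rw [smul_neg, ← hr]
    abel
  · intro H a w u hu
    exact 𝕍.reduction.exists_of_red_eq_bracket (hu.trans (H _ _))

theorem SmoothDeformation.isPoisson {π : BivectorField E M} (hπ : 𝔻.Determines π) :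
    π.IsPoisson := by
  rw [determines_iff] at hπ
  intro f g h
  simp only [hπ]
  rw [𝔻.bracket_antisymm h (𝔻.bracket f g), ← 𝔻.bracket_bracket, 𝔻.bracket_antisymm h f, map_neg]
  abel

/-- Apply the 𝕜-linear d to κ e = i (ab - ba): the derivation rule gives `d(ab - ba) = [a, db] - [b,
da]`, and κ cancels modulo κ. -/
theorem OneFormDeformation.bracket_grad {d : A →ₗ[𝕜] W} (Ω : OneFormDeformation 𝔻 β d)
    (f h : Cc E M) :
    Ω.bracket f (grad h) - Ω.bracket h (grad f) = grad (𝔻.bracket f h) := by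
  obtain ⟨a, rfl⟩ := 𝔻.red_surjective f
  obtain ⟨b, rfl⟩ := 𝔻.red_surjective h
  obtain ⟨e, he⟩ := 𝔻.regular.exists_smul_eq a b
  obtain ⟨u, hu⟩ := Ω.reduction.exists_smul_eq a (d b)
  obtain ⟨u', hu'⟩ := Ω.reduction.exists_smul_eq b (d a)
  rw [𝔻.bracket_red he, ← Ω.red_d, ← Ω.red_d, ← Ω.red_d, Ω.bracket_red hu, Ω.bracket_red hu']
  refine (map_sub Ω.red u u').symm.trans ?_
  refine Ω.reduction.red_eq_of_smul_eq (r := 0) ?_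
  have he' : 𝔻.κ • e = Complex.I • (a * b - b * a) := he
  rw [smul_sub, hu, hu', ← map_smul, he', LinearMap.map_smul_of_tower, map_sub, Ω.d_mul, Ω.d_mul,
    smul_zero, add_zero, ← smul_sub]
  congr 1
  abel

variable [FiniteDimensional ℝ E]

theorem SmoothDeformation.existsUnique_bivectorField (𝔻 : SmoothDeformation E M 𝕜 A) :
    ∃! π : BivectorField E M, 𝔻.Determines π := by
  refine ⟨bivectorOfBiderivation 𝔻.bracket 𝔻.bracket_antisymm 𝔻.bracket_mul,
    determines_iff.2 (bivectorOfBiderivation_bracket _ _), fun π hπ => ?_⟩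
  exact BivectorField.eq_of_bracket_eq fun f h =>
    (determines_iff.1 hπ f h).trans (bivectorOfBiderivation_bracket _ _ f h).symm

/-- The contravariant connection determined by a bimodule deformation. -/
def BimoduleDeformation.connection (𝕍 : BimoduleDeformation 𝔻 F V β) {π : BivectorField E M}
    (hπ : 𝔻.Determines π) : ContravariantConnection π F V where
  op := extendDerivation 𝕍.bracket 𝕍.mul_bracket
  smul_left := extendDerivation_smul 𝕍.mul_bracket
  leibniz σ f v := by
    refine Gc.ext fun x => ?_
    have h0 := grad_potential (σ.1 x)
    rw [Gc.add_apply, Gc.fun_smul_apply, Gc.fun_smul_apply,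
      extendDerivation_apply 𝕍.mul_bracket h0, extendDerivation_apply 𝕍.mul_bracket h0,
      𝕍.bracket_smul, Gc.add_apply, Gc.fun_smul_apply, Gc.fun_smul_apply,
      ← SmoothDeformation.determines_iff.1 hπ]
    congr 2
    change π.toFun x ((grad (potential (σ.1 x))).1 x) _ = π.toFun x (σ.1 x) _
    rw [h0]

theorem BimoduleDeformation.determines_connection (𝕍 : BimoduleDeformation 𝔻 F V β)
    {π : BivectorField E M} (hπ : 𝔻.Determines π) : 𝕍.Determines (𝕍.connection hπ) :=
  𝕍.determines_iff.2 fun f v => extendDerivation_grad 𝕍.mul_bracket f v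

theorem BimoduleDeformation.existsUnique_connection (𝕍 : BimoduleDeformation 𝔻 F V β)
    {π : BivectorField E M} (hπ : 𝔻.Determines π) :
    ∃! 𝒟 : ContravariantConnection π F V, 𝕍.Determines 𝒟 := by
  have h := 𝕍.determines_connection hπ
  refine ⟨𝕍.connection hπ, h, fun 𝒟 h𝒟 => ContravariantConnection.eq_of_op_grad_eq fun f v => ?_⟩
  rw [𝕍.determines_iff.1 h𝒟, 𝕍.determines_iff.1 h]

theorem BimoduleDeformation.op_apply (𝕍 : BimoduleDeformation 𝔻 F V β)
    {π : BivectorField E M} (hπ : 𝔻.Determines π) {𝒟 : ContravariantConnection π F V}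
    (h𝒟 : 𝕍.Determines 𝒟) {σ : Omc E M} {x : M} {h : Cc E M} (H : (grad h).1 x = σ.1 x)
    (v : Gc (E := E) F V) : (𝒟.op σ v).1 x = (𝕍.bracket h v).1 x := by
  rw [(𝕍.existsUnique_connection hπ).unique h𝒟 (𝕍.determines_connection hπ)]
  exact extendDerivation_apply 𝕍.mul_bracket H v

theorem BimoduleDeformation.curvature_eq_zero (𝕍 : BimoduleDeformation 𝔻 F V β)
    {π : BivectorField E M} (hπ : 𝔻.Determines π) {𝒟 : ContravariantConnection π F V}
    (h𝒟 : 𝕍.Determines 𝒟) {B : Omc E M →ₗ[ℂ] Omc E M →ₗ[ℂ] Omc E M}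
    (hB : π.IsKoszulBracket B) (σ ρ : Omc E M) (v : Gc (E := E) F V) :
    𝒟.curvature B σ ρ v = 0 := by
  refine 𝒟.curvature_eq_zero hB v (fun f h => ?_) σ ρ
  rw [ContravariantConnection.curvature, hB.exact_exact, SmoothDeformation.determines_iff.1 hπ]
  simp only [𝕍.determines_iff.1 h𝒟]
  rw [𝕍.bracket_bracket]
  exact sub_self _

theorem OneFormDeformation.isKoszulBracket {d : A →ₗ[𝕜] W} (Ω : OneFormDeformation 𝔻 β d)
    {π : BivectorField E M} (hπ : 𝔻.Determines π) {𝒟 : CotangentConnection π}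
    (h𝒟 : Ω.Determines 𝒟) : π.IsKoszulBracket 𝒟.formBracket := by
  refine 𝒟.isKoszulBracket_formBracket fun f h => ?_
  rw [Ω.determines_iff.1 h𝒟, Ω.determines_iff.1 h𝒟, Ω.bracket_grad,
    SmoothDeformation.determines_iff.1 hπ]

theorem OneFormDeformation.torsion_eq_zero {d : A →ₗ[𝕜] W} (Ω : OneFormDeformation 𝔻 β d)
    {π : BivectorField E M} (hπ : 𝔻.Determines π) {𝒟 : CotangentConnection π}
    (h𝒟 : Ω.Determines 𝒟) {B : Omc E M →ₗ[ℂ] Omc E M →ₗ[ℂ] Omc E M}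
    (hB : π.IsKoszulBracket B) (σ ρ : Omc E M) : 𝒟.torsion B σ ρ = 0 := by
  rw [ContravariantConnection.torsion, hB.unique (Ω.isKoszulBracket hπ h𝒟),
    ContravariantConnection.formBracket_apply]
  exact Gc.ext fun x => sub_self _

end Deformation

/-! ### Clifford action of noncommutative forms and metric compatibility -/

section Metric

variable {E : Type*} [NormedAddCommGroup E] [NormedSpace ℝ E] [FiniteDimensional ℝ E]
  {M : Type*} [TopologicalSpace M] [ChartedSpace E M] [IsManifold 𝓘(ℝ, E) ∞ M] [T2Space M]
  {g : PseudoRiemannianMetric E M}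
  {F : Type*} [NormedAddCommGroup F] [NormedSpace ℝ F] [NormedSpace ℂ F]
  [IsScalarTower ℝ ℂ F]
  {V : M → Type*} [TopologicalSpace (Bundle.TotalSpace F V)] [∀ x, TopologicalSpace (V x)]
  [FiberBundle F V] [∀ x, AddCommGroup (V x)] [∀ x, Module ℂ (V x)] [IsComplexBundle F V]
  [∀ x, Module ℝ (V x)] [VectorBundle ℝ F V]
  {c : CliffordRepresentation g F V}

theorem CliffordRepresentation.mul_add_mul_apply (c : CliffordRepresentation g F V)
    (σ ρ : Omc E M) (v : Gc (E := E) F V) (x : M) :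
    (c.mul σ (c.mul ρ v) + c.mul ρ (c.mul σ v)).1 x =
      (2 * g.cometric x (σ.1 x) (ρ.1 x)) • v.1 x :=
  c.clifford x (σ.1 x) (ρ.1 x) (v.1 x)

/-- The function `g(σ, ρ)` on a manifold with a non-trivial Clifford bundle. -/
def CliffordRepresentation.formInner [FiniteDimensional ℂ F] [Nontrivial F]
    [ContMDiffVectorBundle ∞ F V 𝓘(ℝ, E)] (c : CliffordRepresentation g F V) (σ ρ : Omc E M) :
    Cc E M :=
  ⟨fun x => g.cometric x (σ.1 x) (ρ.1 x), by
    -- By the Clifford relation, g(σ,ρ) s is half an anticommutator of Clifford multiplications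
    -- applied to s, hence smooth.
    refine contMDiff_of_smul_section F V fun s => ?_
    convert ((2 : ℂ)⁻¹ • (c.mul σ (c.mul ρ s) + c.mul ρ (c.mul σ s))).2 using 1
    ext x
    refine Eq.trans ?_ (congrArg ((2 : ℂ)⁻¹ • ·) (c.mul_add_mul_apply σ ρ s x)).symm
    rw [smul_smul, inv_mul_cancel_left₀ two_ne_zero], by
    obtain ⟨K, hK, h⟩ := ρ.2.2
    exact HasCompactSupport.intro' hK hK.isClosed fun x hx => by
      simp [PseudoRiemannianMetric.cometric, h x hx]⟩

variable {𝕜 : Type*} [CommRing 𝕜] [Algebra ℂ 𝕜]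
  {A : Type*} [NonUnitalRing A] [Module 𝕜 A] [Module ℂ A] [IsScalarTower ℂ 𝕜 A]
  [IsScalarTower 𝕜 A A] [SMulCommClass 𝕜 A A]
  {W : Type*} [AddCommGroup W] [Module 𝕜 W] [Module ℂ W] [IsScalarTower ℂ 𝕜 W]

namespace DeformedSpectralTriple

variable (T : DeformedSpectralTriple c 𝕜 A W)

/-- Noncommutative one-forms act on the reduction of the spinors by Clifford multiplication. -/
theorem red_apply (η : T.bimod.ncForms T.D) (w : W) :
    T.spinors.red (η.1 w) = c.mul (T.forms.red η) (T.spinors.red w) := by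
  -- `ncForms` is the smallest sub-bimodule containing the commutators, so it suffices that the
  -- operators with the claimed property form one. Membership is part of the condition because
  -- `T.forms.red` is defined only on `ncForms`.
  let S : Submodule 𝕜 (W →ₗ[𝕜] W) :=
    { carrier := {η | ∃ h : η ∈ T.bimod.ncForms T.D, ∀ w,
        T.spinors.red (η w) = c.mul (T.forms.red ⟨η, h⟩) (T.spinors.red w)}
      add_mem' := by
        rintro η θ ⟨hη, hη'⟩ ⟨hθ, hθ'⟩
        refine ⟨add_mem hη hθ, fun w => ?_⟩
        have h := map_add T.forms.red ⟨η, hη⟩ ⟨θ, hθ⟩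
        rw [LinearMap.add_apply, map_add, hη', hθ']
        refine Eq.trans ?_ (congrArg (c.mul · (T.spinors.red w)) h.symm)
        exact Gc.ext fun x =>
          (LinearMap.congr_fun (map_add (c.toFun x) _ _) ((T.spinors.red w).1 x)).symm
      zero_mem' := by
        refine ⟨zero_mem _, fun w => ?_⟩
        have h := map_zero T.forms.red
        rw [LinearMap.zero_apply, map_zero]
        refine Eq.trans ?_ (congrArg (c.mul · (T.spinors.red w)) h.symm)
        exact Gc.ext fun x =>
          (LinearMap.congr_fun (map_zero (c.toFun x)) ((T.spinors.red w).1 x)).symm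
      smul_mem' := by
        rintro k η ⟨hη, hη'⟩
        refine ⟨Submodule.smul_mem _ k hη, fun w => Gc.ext fun x => ?_⟩
        -- With a reducing to 1 at x, the scalar k acts on forms and on spinors at x by the same
        -- number, the value of `red (k • a)`.
        obtain ⟨χ, hχ, -⟩ := exists_eq_one_nhds_tsupport_subset (E := E) (x₀ := x)
          (Filter.univ_mem)
        obtain ⟨a, rfl⟩ := T.deformation.red_surjective χ
        have ha : (T.deformation.red a).1 x = 1 := hχ.eq_of_nhds
        rw [LinearMap.smul_apply, T.spinors.red_smul_apply k _ ha, hη']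
        have h := T.forms.red_smul_apply k ⟨η, hη⟩ ha
        change _ = c.toFun x ((T.forms.red (k • ⟨η, hη⟩)).1 x) ((T.spinors.red w).1 x)
        rw [h, map_smul (c.toFun x)]
        rfl }
  have hS : T.bimod.ncForms T.D ≤ S := by
    refine sInf_le ⟨fun a => ?_, fun a η hη => ?_, fun a η hη => ?_⟩
    · refine ⟨T.bimod.comm_mem T.D a, fun w => ?_⟩
      obtain ⟨D₀, hD₀, hD⟩ := T.dirac
      -- Since da = -i [D, a], the commutator is i da, matching the factor i in the Dirac-type
      -- condition.
      have h1 : (⟨T.bimod.comm T.D a, T.bimod.comm_mem T.D a⟩ : T.bimod.ncForms T.D) =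
          Complex.I • T.bimod.ncDiff T.D a := by
        change _ = Complex.I • (algebraMap ℂ 𝕜 (-Complex.I) •
          (⟨T.bimod.comm T.D a, T.bimod.comm_mem T.D a⟩ : T.bimod.ncForms T.D))
        rw [algebraMap_smul, smul_smul, mul_neg, Complex.I_mul_I, neg_neg, one_smul]
      have h2 := congrArg T.forms.red h1
      rw [map_smul, T.forms.red_d] at h2
      refine Eq.trans ?_ (congrArg (c.mul · (T.spinors.red w)) h2.symm)
      change T.spinors.red (T.D (T.bimod.left a w) - T.bimod.left a (T.D w)) = _
      rw [map_sub, hD, T.spinors.red_left, T.spinors.red_left, hD, hD₀]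
      exact Gc.ext fun x =>
        (LinearMap.congr_fun (map_smul (c.toFun x) Complex.I _) ((T.spinors.red w).1 x)).symm
    · obtain ⟨hη, hη'⟩ := hη
      refine ⟨T.bimod.left_comp_mem T.D a hη, fun w => ?_⟩
      have h := T.forms.red_left a ⟨η, hη⟩
      rw [LinearMap.comp_apply, T.spinors.red_left, hη']
      refine Eq.trans ?_ (congrArg (c.mul · (T.spinors.red w)) h.symm)
      exact Gc.ext fun x =>
        (LinearMap.congr_fun (map_smul (c.toFun x) _ _) ((T.spinors.red w).1 x)).symm
    · obtain ⟨hη, hη'⟩ := hη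
      refine ⟨T.bimod.comp_left_mem T.D a hη, fun w => ?_⟩
      have h := T.forms.red_right a ⟨η, hη⟩
      rw [LinearMap.comp_apply, hη', T.spinors.red_left]
      refine Eq.trans ?_ (congrArg (c.mul · (T.spinors.red w)) h.symm)
      refine Gc.ext fun x => ?_
      refine (map_smul (c.toFun x _) _ _).trans ?_
      exact (LinearMap.congr_fun (map_smul (c.toFun x) _ _) ((T.spinors.red w).1 x)).symm
  exact (hS η.2).2 w

/-- Noncommutative one-forms commute with the right action of the algebra. -/
theorem apply_right (η : T.bimod.ncForms T.D) (a : A) (w : W) :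
    η.1 (T.bimod.right a w) = T.bimod.right a (η.1 w) := by
  let S : Submodule 𝕜 (W →ₗ[𝕜] W) :=
    { carrier := {η | ∀ a w, η (T.bimod.right a w) = T.bimod.right a (η w)}
      add_mem' := fun hη hθ a w => by
        rw [LinearMap.add_apply, LinearMap.add_apply, hη, hθ, map_add]
      zero_mem' := fun a w => by simp
      smul_mem' := fun k η hη a w => by
        rw [LinearMap.smul_apply, LinearMap.smul_apply, hη, map_smul] }
  have hS : T.bimod.ncForms T.D ≤ S := by
    refine sInf_le ⟨fun a b w => T.comm_right a b w, fun a η hη b w => ?_, fun a η hη b w => ?_⟩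
    · rw [LinearMap.comp_apply, LinearMap.comp_apply, hη, T.bimod.left_right]
    · rw [LinearMap.comp_apply, LinearMap.comp_apply, T.bimod.left_right, hη]
  exact hS η.2 a w

end DeformedSpectralTriple

/-- If an operator `Q` that commutes with the right action reduces to multiplication by a function,
then the bracket with this function is the reduction of `κ⁻¹ i [a, Q]`. -/
theorem BimoduleDeformation.red_eq_bracket_smul {𝔻 : SmoothDeformation E M 𝕜 A}
    {β : Bimod 𝕜 A W} (𝕍 : BimoduleDeformation 𝔻 F V β) (Q : W →ₗ[𝕜] W)
    (hQ : ∀ a w, Q (β.right a w) = β.right a (Q w)) {k : Cc E M}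
    (hk : ∀ w, 𝕍.red (Q w) = k • 𝕍.red w) {a : A} {w u : W}
    (hu : 𝔻.κ • u = Complex.I • (β.left a (Q w) - Q (β.left a w))) :
    𝕍.red u = 𝔻.bracket (𝔻.red a) k • 𝕍.red w := by
  obtain ⟨b, rfl⟩ := 𝔻.red_surjective k
  -- Q and left multiplication by b agree modulo κ, so Q = b + κP. P is a mere choice of function,
  -- and every property of it is read off after multiplying by κ.
  have hP : ∀ w, ∃ p, Q w - β.left b w = 𝔻.κ • p := fun w =>
    (𝕍.red_eq_zero_iff _).1 (by
      rw [map_sub, hk, 𝕍.red_left]; exact Gc.ext fun x => sub_self _)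
  choose P hP using hP
  -- Both Q and left multiplication by b commute with the right action, hence P does modulo κ.
  have h1 : 𝕍.red (P (β.right a w)) = 𝕍.red (β.right a (P w)) :=
    𝕍.reduction.red_eq_of_smul_eq (r := 0) (by
      rw [← map_smul (β.right a), ← hP, ← hP, hQ, map_sub, β.left_right, smul_zero, add_zero])
  -- Writing aw - wa = κ y, the two values of κP differ by (Q - b)(κ y) = κ² P y.
  have h2 : 𝕍.red (P (β.left a w)) = 𝕍.red (P (β.right a w)) := by
    obtain ⟨y, hy⟩ := (𝕍.red_eq_zero_iff (β.left a w - β.right a w)).1 (by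
      rw [map_sub, 𝕍.red_left, 𝕍.red_right]; exact Gc.ext fun x => sub_self _)
    refine 𝕍.reduction.red_eq_of_smul_eq (r := P y) ?_
    rw [← hP, ← hP, sq, mul_smul, ← hP y, smul_sub, ← map_smul Q, ← map_smul (β.left b), ← hy,
      map_sub, map_sub]
    abel
  obtain ⟨e, he⟩ := 𝔻.regular.exists_smul_eq a b
  replace he : 𝔻.κ • e = Complex.I • (a * b - b * a) := he
  -- Now [a, Q] = [a, b] + κ [a, P]; the previous steps make the second commutator vanish modulo κ.
  have h3 : 𝕍.red u = 𝕍.red (β.left e w + Complex.I • (β.left a (P w) - P (β.left a w))) := by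
    refine 𝕍.reduction.red_eq_of_smul_eq (r := 0) ?_
    have h4 : 𝔻.κ • β.left e w = β.left (𝔻.κ • e) w := by rw [map_smul, LinearMap.smul_apply]
    have hP' : ∀ w, Q w = β.left b w + 𝔻.κ • P w := fun w => by rw [← hP w]; abel
    rw [hu, hP' w, hP' (β.left a w), smul_add, h4, he, smul_comm 𝔻.κ Complex.I, smul_zero,
      LinearMap.map_smul_of_tower, LinearMap.smul_apply, ← smul_add, add_zero]
    congr 1
    simp only [map_sub, map_add, LinearMap.sub_apply, β.left_mul, smul_sub, map_smul]
    abel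
  rw [h3, map_add, 𝕍.red_left, map_smul, map_sub, 𝕍.red_left, h2, h1, 𝕍.red_right,
    ← 𝔻.bracket_red he]
  have h5 : 𝔻.red a • 𝕍.red (P w) - 𝔻.red a • 𝕍.red (P w) = 0 := Gc.ext fun x => sub_self _
  rw [h5, smul_zero, add_zero]

namespace DeformedSpectralTriple

variable [FiniteDimensional ℂ F] [Nontrivial F] [ContMDiffVectorBundle ∞ F V 𝓘(ℝ, E)]
  (T : DeformedSpectralTriple c 𝕜 A W)

/-- The brackets are compatible with the inner product of one-forms. -/
theorem bracket_formInner (f : Cc E M) (σ ρ : Omc E M) :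
    T.deformation.bracket f (c.formInner σ ρ) =
      c.formInner (T.forms.bracket f σ) ρ + c.formInner σ (T.forms.bracket f ρ) := by
  obtain ⟨a, rfl⟩ := T.deformation.red_surjective f
  obtain ⟨η, rfl⟩ := T.forms.red_surjective σ
  obtain ⟨θ, rfl⟩ := T.forms.red_surjective ρ
  obtain ⟨ξ, hξ⟩ := T.forms.reduction.exists_smul_eq a η
  obtain ⟨ζ, hζ⟩ := T.forms.reduction.exists_smul_eq a θ
  rw [T.forms.bracket_red hξ, T.forms.bracket_red hζ]
  -- The bimodule actions on forms are compositions with left multiplication, so ξ is i [a, η]/κ as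
  -- an operator on spinors.
  have hact : ∀ η ξ : T.bimod.ncForms T.D, T.deformation.κ • ξ = Complex.I •
      ((T.bimod.ncBimod T.D).left a η - (T.bimod.ncBimod T.D).right a η) → ∀ w,
      T.deformation.κ • ξ.1 w =
        Complex.I • (T.bimod.left a (η.1 w) - η.1 (T.bimod.left a w)) := fun η ξ h w => by
    have := congrArg (fun η : T.bimod.ncForms T.D => η.1 w) h
    exact this
  let Q : W →ₗ[𝕜] W := η.1 ∘ₗ θ.1 + θ.1 ∘ₗ η.1
  refine Cc.ext fun x => ?_
  -- Scalars at x are compared through their action on a spinor that does not vanish there.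
  obtain ⟨v, hv⟩ := exists_section_ne_zero (E := E) F V x
  obtain ⟨w, rfl⟩ := T.spinors.red_surjective v
  have key := T.spinors.red_eq_bracket_smul Q (fun b w => by
      simp only [Q, LinearMap.add_apply, LinearMap.comp_apply, T.apply_right, map_add])
    (k := (2 : ℂ) • c.formInner (T.forms.red η) (T.forms.red θ)) (fun w => by
      simp only [Q, LinearMap.add_apply, LinearMap.comp_apply, map_add, T.red_apply]
      exact Gc.ext fun y => c.mul_add_mul_apply _ _ _ y) (a := a) (w := w)
    -- The Leibniz rule for [a, Q], grouped into the anticommutators of ξ, θ and of η, ζ so that the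
    -- Clifford relation applies to each.
    (u := (ξ.1 (θ.1 w) + θ.1 (ξ.1 w)) + (η.1 (ζ.1 w) + ζ.1 (η.1 w))) (by
      simp only [smul_add, hact η ξ hξ, hact θ ζ hζ, ← map_smul]
      simp only [Q, LinearMap.add_apply, LinearMap.comp_apply, LinearMap.map_smul_of_tower, map_sub,
        map_add, smul_sub, smul_add]
      abel)
  rw [map_add, map_add, map_add] at key
  simp only [T.red_apply] at key
  have h1 := c.mul_add_mul_apply (T.forms.red ξ) (T.forms.red θ) (T.spinors.red w) x
  have h2 := c.mul_add_mul_apply (T.forms.red η) (T.forms.red ζ) (T.spinors.red w) x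
  rw [map_smul] at key
  have hx := congrArg (Gc.eval F V x) key
  have h3 := (congrArg₂ (· + ·) h1 h2).symm.trans hx
  change _ = (2 * (T.deformation.bracket (T.deformation.red a)
    (c.formInner (T.forms.red η) (T.forms.red θ))).1 x) • (T.spinors.red w).1 x at h3
  have h4 := smul_left_injective ℂ hv ((add_smul _ _ _).trans h3)
  rw [← mul_add] at h4
  exact (mul_left_cancel₀ two_ne_zero h4).symm

/-- At x each term depends on σ only through its value there, so σ may be replaced by the
differential of a potential and `bracket_formInner` applies. -/
theorem isMetricCompatible {π : BivectorField E M} (hπ : T.deformation.Determines π)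
    {𝒟 : CotangentConnection π} (h𝒟 : T.forms.Determines 𝒟) : 𝒟.IsMetricCompatible g := by
  intro σ ρ τ x
  have h0 := grad_potential (σ.1 x)
  rw [T.forms.op_apply hπ h𝒟 h0, T.forms.op_apply hπ h𝒟 h0]
  have h := T.bracket_formInner (potential (σ.1 x)) ρ τ
  rw [← SmoothDeformation.determines_iff.1 hπ] at h
  have hx := congrArg (fun k : Cc E M => k.1 x) h
  change π.toFun x ((grad (potential (σ.1 x))).1 x) ((grad (c.formInner ρ τ)).1 x) = _ at hx
  rw [h0] at hx
  exact hx

end DeformedSpectralTriple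

end Metric

end DeformedGeometry

end

theorem mainTheorem2
    {E : Type*} [NormedAddCommGroup E] [NormedSpace ℝ E] [FiniteDimensional ℝ E]
    {M : Type*} [TopologicalSpace M] [ChartedSpace E M] [IsManifold 𝓘(ℝ, E) ∞ M]
    [T2Space M] [SigmaCompactSpace M]
    (g : PseudoRiemannianMetric E M)
    {F : Type*} [NormedAddCommGroup F] [NormedSpace ℝ F] [NormedSpace ℂ F] [IsScalarTower ℝ ℂ F]
    [FiniteDimensional ℂ F] [Nontrivial F]
    {V : M → Type*} [TopologicalSpace (Bundle.TotalSpace F V)] [∀ x, TopologicalSpace (V x)]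
    [FiberBundle F V] [∀ x, AddCommGroup (V x)] [∀ x, Module ℂ (V x)] [IsComplexBundle F V]
    [∀ x, Module ℝ (V x)] [VectorBundle ℝ F V] [ContMDiffVectorBundle ∞ F V 𝓘(ℝ, E)]
    (c : CliffordRepresentation g F V)
    {𝕜 : Type*} [CommRing 𝕜] [Algebra ℂ 𝕜]
    {A : Type*} [NonUnitalRing A] [Module 𝕜 A] [Module ℂ A] [IsScalarTower ℂ 𝕜 A]
    [IsScalarTower 𝕜 A A] [SMulCommClass 𝕜 A A]
    {W : Type*} [AddCommGroup W] [Module 𝕜 W] [Module ℂ W] [IsScalarTower ℂ 𝕜 W]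
    (T : DeformedSpectralTriple c 𝕜 A W) :
    (∃! π : BivectorField E M, T.deformation.Determines π) ∧
    ∀ π : BivectorField E M, T.deformation.Determines π →
      π.IsPoisson ∧
      (∃! B : Omc E M →ₗ[ℂ] Omc E M →ₗ[ℂ] Omc E M, π.IsKoszulBracket B) ∧
      (∃! 𝒟 : CotangentConnection π, T.forms.Determines 𝒟) ∧
      ∀ 𝒟 : CotangentConnection π, T.forms.Determines 𝒟 →
        (∀ B : Omc E M →ₗ[ℂ] Omc E M →ₗ[ℂ] Omc E M, π.IsKoszulBracket B →
          (∀ σ ρ τ, 𝒟.curvature B σ ρ τ = 0) ∧ ∀ σ ρ, 𝒟.torsion B σ ρ = 0) ∧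
        𝒟.IsMetricCompatible g := by
  refine ⟨T.deformation.existsUnique_bivectorField, fun π hπ => ⟨T.deformation.isPoisson hπ, ?_,
    T.forms.existsUnique_connection hπ, fun 𝒟 h𝒟 => ⟨fun B hB => ⟨fun σ ρ τ => ?_, fun σ ρ => ?_⟩,
      T.isMetricCompatible hπ h𝒟⟩⟩⟩
  -- The Koszul bracket is obtained by antisymmetrising the connection of the form deformation.
  · obtain ⟨𝒟, h𝒟, -⟩ := T.forms.existsUnique_connection hπ
    have hB := T.forms.isKoszulBracket hπ h𝒟
    exact ⟨_, hB, fun B hB' => hB'.unique hB⟩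
  · exact T.forms.curvature_eq_zero hπ h𝒟 hB σ ρ τ
  · exact T.forms.torsion_eq_zero hπ h𝒟 hB σ ρ
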